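/- Let $k$ be an algebraically closed field of characteristic $2$. Paths in quivers are composed from left to right. For $r\ge 2$ let $C_r=kQ/I$, where $Q$ is the quiver with vertices $1,2,3$ and arrows $a_1:1\to 2$, $a_2:2\to 3$, $b_1:2\to 1$, $b_2:3\to 2$, $c:3\to 3$, and $I$ is the ideal given by the relations $$a_1b_1=b_2a_2=a_2c=cb_2=0,\qquad c^r=b_2b_1a_1a_2,\qquad a_2b_2b_1a_1=b_1a_1a_2b_2 .$$ For $r=1$ let $C_1:=A_1$ be the algebra of the quiver with vertices $1,2,3$ and arrows $a_1:1\to 2$, $a_2:2\to 1$, $b_1:1\to 3$, $b_2:3\to 1$, with relations $$a_2a_1=b_2b_1=0,\qquad a_1a_2b_1b_2=b_1b_2a_1a_2 .$$ A finite dimensional $k$-algebra $A$ is called tightly graded if there is an isomorphism of $k$-algebras $A\cong \operatorname{gr}(A)=\bigoplus_{n\ge 0}\operatorname{rad}^nA/\operatorname{rad}^{n+1}A$. A tight grading on $A$ is a grading $A=\bigoplus_{i\ge 0}A_i$ such that $A_0$ is semisimple and $A$ is generated, as an algebra, by $A_0$ and $A_1$. Proposition. For every integer $r\ge 1$, the algebra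 $C_r$ is tightly graded if and only if $r=1$ or $r=4$. Likewise, $C_r$ admits a tight grading if and only if $r=1$ or $r=4$. -/

import Mathlib

universe u

section PathAlgebras

/-- The defining relations of the path algebra of a quiver with finitely many vertices, on the
generators `v` (the trivial path at a vertex `v`) and `f` (an arrow `f : v ⟶ w`): the trivial paths
are orthogonal idempotents with sum `1`, and an arrow `f : v ⟶ w` satisfies
`e_v * f = f = f * e_w`.  Paths are composed from left to right. -/
inductive PathRel (k : Type u) [Field k] (V : Type) [Fintype V] [Quiver.{0} V] :
    FreeAlgebra k (V ⊕ Quiver.Total V) → FreeAlgebra k (V ⊕ Quiver.Total V) → Prop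
  | idem (v : V) : PathRel k V
      (FreeAlgebra.ι k (Sum.inl v) * FreeAlgebra.ι k (Sum.inl v)) (FreeAlgebra.ι k (Sum.inl v))
  | orth (v w : V) (h : v ≠ w) : PathRel k V
      (FreeAlgebra.ι k (Sum.inl v) * FreeAlgebra.ι k (Sum.inl w)) 0
  | sum_one : PathRel k V (∑ v : V, FreeAlgebra.ι k (Sum.inl v)) 1
  | source (f : Quiver.Total V) : PathRel k V
      (FreeAlgebra.ι k (Sum.inl f.left) * FreeAlgebra.ι k (Sum.inr f)) (FreeAlgebra.ι k (Sum.inr f))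
  | target (f : Quiver.Total V) : PathRel k V
      (FreeAlgebra.ι k (Sum.inr f) * FreeAlgebra.ι k (Sum.inl f.right))
      (FreeAlgebra.ι k (Sum.inr f))

/-- The path algebra `kQ` of a quiver with finitely many vertices. -/
def PathAlgebra (k : Type u) [Field k] (V : Type) [Fintype V] [Quiver.{0} V] : Type u :=
  RingQuot (PathRel k V)

noncomputable instance (k : Type u) [Field k] (V : Type) [Fintype V] [Quiver.{0} V] :
    Ring (PathAlgebra k V) :=
  inferInstanceAs (Ring (RingQuot (PathRel k V)))

noncomputable instance (k : Type u) [Field k] (V : Type) [Fintype V] [Quiver.{0} V] :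
    Algebra k (PathAlgebra k V) :=
  inferInstanceAs (Algebra k (RingQuot (PathRel k V)))

/-- The trivial path at a vertex. -/
noncomputable def PathAlgebra.vertex (k : Type u) [Field k] {V : Type} [Fintype V] [Quiver.{0} V]
    (v : V) : PathAlgebra k V :=
  RingQuot.mkAlgHom k (PathRel k V) (FreeAlgebra.ι k (Sum.inl v))

/-- The path of length one given by an arrow. -/
noncomputable def PathAlgebra.arrow (k : Type u) [Field k] {V : Type} [Fintype V] [Quiver.{0} V]
    {v w : V} (f : v ⟶ w) : PathAlgebra k V :=
  RingQuot.mkAlgHom k (PathRel k V) (FreeAlgebra.ι k (Sum.inr ⟨v, w, f⟩))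

/-- A quiver with finitely many vertices, with relations `x = y` in its path algebra. -/
structure QuiverWithRelations (k : Type u) [Field k] where
  V : Type
  [fintypeV : Fintype V]
  [quiverV : Quiver.{0} V]
  rel : PathAlgebra k V → PathAlgebra k V → Prop

attribute [instance] QuiverWithRelations.fintypeV QuiverWithRelations.quiverV

/-- The algebra `kQ / I` given by a quiver with relations: `I` is the two-sided ideal generated by
the elements `x - y`, for all relations `x = y`. -/
def QuiverWithRelations.QuotAlgebra {k : Type u} [Field k] (Q : QuiverWithRelations k) : Type u :=
  RingQuot Q.rel

noncomputable instance {k : Type u} [Field k] (Q : QuiverWithRelations k) : Ring Q.QuotAlgebra :=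
  inferInstanceAs (Ring (RingQuot Q.rel))

noncomputable instance {k : Type u} [Field k] (Q : QuiverWithRelations k) :
    Algebra k Q.QuotAlgebra :=
  inferInstanceAs (Algebra k (RingQuot Q.rel))

end PathAlgebras

section BlockAlgebras

/-- The vertices of the quiver of `A_r`. -/
inductive AVertex : Type
  | v1 | v2 | v3
  deriving DecidableEq

instance : Fintype AVertex :=
  Fintype.ofList [.v1, .v2, .v3] (by intro x; cases x <;> simp)

/-- The arrows of the quiver of `A_r`. -/
inductive AArrow : AVertex → AVertex → Type
  | a1 : AArrow .v1 .v2
  | a2 : AArrow .v2 .v1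
  | b1 : AArrow .v1 .v3
  | b2 : AArrow .v3 .v1

instance : Quiver.{0} AVertex := ⟨AArrow⟩

/-- An arrow of the quiver of `A_r` as an element of the path algebra. -/
noncomputable def AArrow.path (k : Type u) [Field k] {v w : AVertex} (f : AArrow v w) :
    PathAlgebra k AVertex :=
  PathAlgebra.arrow k (show v ⟶ w from f)

open AArrow in
/-- The relations of `A_r`: `a₂a₁ = b₂b₁ = 0`, `(a₁a₂b₁b₂)^r = (b₁b₂a₁a₂)^r`. -/
inductive ARel (k : Type u) [Field k] (r : ℕ) :
    PathAlgebra k AVertex → PathAlgebra k AVertex → Prop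
  | a2a1 : ARel k r (a2.path k * a1.path k) 0
  | b2b1 : ARel k r (b2.path k * b1.path k) 0
  | pow : ARel k r ((a1.path k * a2.path k * b1.path k * b2.path k) ^ r)
      ((b1.path k * b2.path k * a1.path k * a2.path k) ^ r)

/-- The quiver with relations of `A_r`, for `r ≥ 1`. -/
def quiverA (k : Type u) [Field k] (r : ℕ) : QuiverWithRelations k where
  V := AVertex
  rel := ARel k r

/-- The vertices of the quiver of `C_r`, `r ≥ 2`. -/
inductive CVertex : Type
  | v1 | v2 | v3
  deriving DecidableEq

instance : Fintype CVertex :=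
  Fintype.ofList [.v1, .v2, .v3] (by intro x; cases x <;> simp)

/-- The arrows of the quiver of `C_r`, `r ≥ 2`. -/
inductive CArrow : CVertex → CVertex → Type
  | a1 : CArrow .v1 .v2
  | a2 : CArrow .v2 .v3
  | b1 : CArrow .v2 .v1
  | b2 : CArrow .v3 .v2
  | c : CArrow .v3 .v3

instance : Quiver.{0} CVertex := ⟨CArrow⟩

/-- An arrow of the quiver of `C_r` as an element of the path algebra. -/
noncomputable def CArrow.path (k : Type u) [Field k] {v w : CVertex} (f : CArrow v w) :
    PathAlgebra k CVertex :=
  PathAlgebra.arrow k (show v ⟶ w from f)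

open CArrow in
/-- The relations of `C_r`, `r ≥ 2`: `a₁b₁ = b₂a₂ = a₂c = cb₂ = 0`, `c^r = b₂b₁a₁a₂`,
`a₂b₂b₁a₁ = b₁a₁a₂b₂`. -/
inductive CRel (k : Type u) [Field k] (r : ℕ) :
    PathAlgebra k CVertex → PathAlgebra k CVertex → Prop
  | a1b1 : CRel k r (a1.path k * b1.path k) 0
  | b2a2 : CRel k r (b2.path k * a2.path k) 0
  | a2c : CRel k r (a2.path k * c.path k) 0
  | cb2 : CRel k r (c.path k * b2.path k) 0
  | pow : CRel k r (c.path k ^ r) (b2.path k * b1.path k * a1.path k * a2.path k)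
  | comm : CRel k r (a2.path k * b2.path k * b1.path k * a1.path k)
      (b1.path k * a1.path k * a2.path k * b2.path k)

/-- The quiver with relations of `C_r`, for `r ≥ 1`; by convention, `C_1 = A_1`. -/
def quiverC (k : Type u) [Field k] (r : ℕ) : QuiverWithRelations k :=
  if r = 1 then quiverA k 1 else
    { V := CVertex
      rel := CRel k r }

/-- The algebra `C_r`, for `r ≥ 1`. -/
abbrev BlockC (k : Type u) [Field k] (r : ℕ) : Type u :=
  (quiverC k r).QuotAlgebra

end BlockAlgebras

section RadicalGradedAlgebra

variable (k : Type u) [Field k] (A : Type u) [Ring A] [Algebra k A]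

/-- The radical filtration `A = rad⁰ A ⊇ rad¹ A ⊇ rad² A ⊇ …`. -/
def radFiltration (n : ℕ) : Submodule k A :=
  (Ring.jacobson A ^ n : Ideal A).restrictScalars k

/-- The `n`-th component `radⁿ A / radⁿ⁺¹ A` of the graded algebra of the radical filtration. -/
def RadPiece (n : ℕ) : Type u :=
  radFiltration k A n ⧸ (radFiltration k A (n + 1)).submoduleOf (radFiltration k A n)

instance (n : ℕ) : AddCommGroup (RadPiece k A n) :=
  inferInstanceAs (AddCommGroup
    (radFiltration k A n ⧸ (radFiltration k A (n + 1)).submoduleOf (radFiltration k A n)))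

instance (n : ℕ) : Module k (RadPiece k A n) :=
  inferInstanceAs (Module k
    (radFiltration k A n ⧸ (radFiltration k A (n + 1)).submoduleOf (radFiltration k A n)))

variable {k A}

theorem radFiltration_mul_mem {m n : ℕ} {x y : A} (hx : x ∈ radFiltration k A m)
    (hy : y ∈ radFiltration k A n) : x * y ∈ radFiltration k A (m + n) := by
  change x * y ∈ Ring.jacobson A ^ (m + n)
  rw [Ideal.IsTwoSided.pow_add]
  exact Ideal.mul_mem_mul hx hy

variable (k A) in
theorem radFiltration_zero : radFiltration k A 0 = ⊤ := by
  ext x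
  change x ∈ Ring.jacobson A ^ 0 ↔ _
  simp [Submodule.pow_zero]

/-- The class in `radⁿ A / radⁿ⁺¹ A` of an element of `radⁿ A`. -/
def radClass {n : ℕ} (x : A) (hx : x ∈ radFiltration k A n) : RadPiece k A n :=
  Submodule.Quotient.mk ⟨x, hx⟩

theorem radClass_eq_zero {n : ℕ} {x : A} (hx : x ∈ radFiltration k A n)
    (hx' : x ∈ radFiltration k A (n + 1)) : (radClass x hx : RadPiece k A n) = 0 :=
  (Submodule.Quotient.mk_eq_zero _).2 hx'

/-- The multiplication `radᵐ A × radⁿ A → radᵐ⁺ⁿ A`, followed by the projection to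
`radᵐ⁺ⁿ A / radᵐ⁺ⁿ⁺¹ A`. -/
def radMulAux (m n : ℕ) :
    radFiltration k A m →ₗ[k] radFiltration k A n →ₗ[k] RadPiece k A (m + n) :=
  LinearMap.mk₂ k (fun x y => radClass (x.1 * y.1) (radFiltration_mul_mem x.2 y.2))
    (fun x x' y => congrArg Submodule.Quotient.mk (Subtype.ext (add_mul x.1 x'.1 y.1)))
    (fun c x y => congrArg Submodule.Quotient.mk (Subtype.ext (smul_mul_assoc c x.1 y.1)))
    (fun x y y' => congrArg Submodule.Quotient.mk (Subtype.ext (mul_add x.1 y.1 y'.1)))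
    (fun c x y => congrArg Submodule.Quotient.mk (Subtype.ext (mul_smul_comm c x.1 y.1)))

/-- The multiplication `radᵐ A / radᵐ⁺¹ A × radⁿ A / radⁿ⁺¹ A → radᵐ⁺ⁿ A / radᵐ⁺ⁿ⁺¹ A` induced by
that of `A`. -/
def radMul (m n : ℕ) : RadPiece k A m →ₗ[k] RadPiece k A n →ₗ[k] RadPiece k A (m + n) :=
  Submodule.liftQ _
    (LinearMap.flip (Submodule.liftQ _ (radMulAux m n).flip (by
      intro y hy
      refine LinearMap.mem_ker.2 (LinearMap.ext fun x => radClass_eq_zero _ ?_)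
      exact radFiltration_mul_mem (n := n + 1) x.2 hy)))
    (by
      intro x hx
      refine LinearMap.mem_ker.2 (LinearMap.ext fun y => ?_)
      obtain ⟨y, rfl⟩ := Submodule.Quotient.mk_surjective _ y
      refine radClass_eq_zero (n := m + n) _ ?_
      rw [Nat.add_right_comm]
      exact radFiltration_mul_mem (m := m + 1) hx y.2)

theorem radMul_radClass {m n : ℕ} {x y : A} (hx : x ∈ radFiltration k A m)
    (hy : y ∈ radFiltration k A n) :
    radMul m n (radClass x hx) (radClass y hy) =
      (radClass (x * y) (radFiltration_mul_mem hx hy) : RadPiece k A (m + n)) :=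
  rfl

theorem exists_radClass {n : ℕ} (a : RadPiece k A n) :
    ∃ (x : A) (hx : x ∈ radFiltration k A n), a = radClass x hx := by
  obtain ⟨⟨x, hx⟩, rfl⟩ := Submodule.Quotient.mk_surjective _ a
  exact ⟨x, hx, rfl⟩

theorem mk_radClass_eq {m n : ℕ} (h : m = n) {x y : A} (hxy : x = y)
    (hx : x ∈ radFiltration k A m) (hy : y ∈ radFiltration k A n) :
    (GradedMonoid.mk m (radClass x hx) : GradedMonoid (RadPiece k A)) =
      GradedMonoid.mk n (radClass y hy) := by
  subst h hxy
  rfl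

variable (k A) in
/-- The class in `A / rad A` of an element of `A`. -/
def radClassZero : A →ₗ[k] RadPiece k A 0 where
  toFun x := radClass x (radFiltration_zero k A ▸ Submodule.mem_top)
  map_add' _ _ := rfl
  map_smul' _ _ := rfl

instance : GradedMonoid.GOne (RadPiece k A) where
  one := radClassZero k A 1

instance : GradedMonoid.GMul (RadPiece k A) where
  mul {m n} a b := radMul m n a b

instance : DirectSum.GRing (RadPiece k A) where
  mul_zero a := map_zero _
  zero_mul b := LinearMap.map_zero₂ _ b
  mul_add a b c := map_add _ b c
  add_mul a b c := LinearMap.map_add₂ _ a b c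
  one_mul := by
    rintro ⟨n, a⟩
    obtain ⟨x, hx, rfl⟩ := exists_radClass a
    exact mk_radClass_eq (zero_add n) (one_mul x) _ _
  mul_one := by
    rintro ⟨n, a⟩
    obtain ⟨x, hx, rfl⟩ := exists_radClass a
    exact mk_radClass_eq (add_zero n) (mul_one x) _ _
  mul_assoc := by
    rintro ⟨m, a⟩ ⟨n, b⟩ ⟨l, c⟩
    obtain ⟨x, hx, rfl⟩ := exists_radClass a
    obtain ⟨y, hy, rfl⟩ := exists_radClass b
    obtain ⟨z, hz, rfl⟩ := exists_radClass c
    exact mk_radClass_eq (add_assoc m n l) (mul_assoc x y z) _ _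
  natCast n := radClassZero k A n
  natCast_zero := by rw [Nat.cast_zero, map_zero]
  natCast_succ n := by
    rw [Nat.cast_succ, map_add]
    rfl
  intCast n := radClassZero k A n
  intCast_ofNat n := by rw [Int.cast_natCast]
  intCast_negSucc_ofNat n := by rw [Int.cast_negSucc, map_neg]

instance : DirectSum.GAlgebra k (RadPiece k A) where
  toFun := ((radClassZero k A).comp (Algebra.linearMap k A)).toAddMonoidHom
  map_one := congrArg (radClassZero k A) (map_one (algebraMap k A))
  map_mul c d := mk_radClass_eq (zero_add 0).symm (map_mul (algebraMap k A) c d) _ _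
  commutes c := by
    rintro ⟨n, a⟩
    obtain ⟨x, hx, rfl⟩ := exists_radClass a
    exact mk_radClass_eq ((zero_add n).trans (add_zero n).symm) (Algebra.commutes c x) _ _
  smul_def c := by
    rintro ⟨n, a⟩
    obtain ⟨x, hx, rfl⟩ := exists_radClass a
    exact mk_radClass_eq (zero_add n).symm (Algebra.smul_def c x) (Submodule.smul_mem _ c hx) _

variable (k A)

/-- The graded algebra `gr A = ⨁ₙ radⁿ A / radⁿ⁺¹ A` of the radical filtration. -/
abbrev RadGraded : Type u := DirectSum ℕ (RadPiece k A)

/-- `A` is tightly graded: it is isomorphic, as a `k`-algebra, to `gr A`. -/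
def IsTightlyGraded : Prop :=
  Nonempty (A ≃ₐ[k] RadGraded k A)

/-- `A` admits a tight grading: a grading `A = ⨁_{i ≥ 0} A_i` such that `A_0` is a semisimple
algebra and `A` is generated, as an algebra, by `A_0` and `A_1`. -/
def HasTightGrading : Prop :=
  ∃ (𝒜 : ℕ → Submodule k A) (_ : GradedAlgebra 𝒜),
    IsSemisimpleRing (𝒜 0) ∧ Algebra.adjoin k ((𝒜 0 : Set A) ∪ (𝒜 1 : Set A)) = ⊤

end RadicalGradedAlgebra

/-!
For a finite-dimensional algebra `A`, a grading with semisimple `A₀` which is generated in degrees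
`0` and `1` satisfies `radⁿ A = ⨁_{i ≥ n} A_i` (`radFiltration_eq_gradedTail`). Hence it identifies
`A` with `gr A`. Conversely, `gr A` carries such a grading, so that the two properties in the
theorem are equivalent (`isTightlyGraded_iff_hasTightGrading`).

The relations of `C_1 = A_1` and of `C_4` are homogeneous when all arrows have degree `1`. They are
therefore preserved by the homomorphism `δ : A → A[X]` that multiplies each arrow by `X`, and the
elements `a` with `δ a = a Xⁿ` are the components of a tight grading
(`QuiverWithRelations.hasTightGrading`).

For other `r`, the relation `c^r = b₂b₁a₁a₂` is an obstruction. In a tightly graded algebra, if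
`x ∈ radⁿ` and `x · rad ⊆ radⁿ⁺²`, then the component `y` of `x` of degree `n` is congruent to `x`
modulo `radⁿ⁺¹` and annihilates the radical
(`exists_sub_mem_radFiltration_and_mul_eq_zero`). For `r < 4` this is applied to `x = c^(r - 1)` and
`n = r - 1`: as `radʳ · c = 0`, it follows that `c^r = x c = y c = 0`. For `r > 4` it is applied to
`x = b₂b₁a₁` and `n = 3`: as `rad⁴ · a₂ = 0`, it follows that `c^r = x a₂ = y a₂ = 0`. Both
contradict `CArrow.c_pow_ne_zero`, which is read off from an explicit representation.
The radical is identified with the ideal generated by the arrows, which is nilpotent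
(`IsPathFamily.radFiltration_eq`).
-/

/-! ### The Jacobson radical and its powers -/

/-- A left ideal consisting of nilpotent elements is contained in the Jacobson radical. -/
theorem le_ringJacobson_of_forall_isNilpotent {R : Type*} [Ring R] (I : Ideal R)
    (hI : ∀ x ∈ I, IsNilpotent x) : I ≤ Ring.jacobson R := by
  rw [Ring.jacobson_eq_sInf_isMaximal]
  refine le_sInf fun m hm => ?_
  have hm' : m.IsMaximal := hm
  by_contra hle
  have htop : I ⊔ m = ⊤ := hm'.1.2 _ (lt_of_le_of_ne le_sup_right fun h => hle (h ▸ le_sup_left))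
  obtain ⟨x, hx, y, hy, hxy⟩ := Submodule.mem_sup.1 (htop ▸ Submodule.mem_top : (1 : R) ∈ I ⊔ m)
  refine hm'.ne_top (Ideal.eq_top_of_isUnit_mem _ hy ?_)
  rw [eq_sub_of_add_eq' hxy]
  exact (hI x hx).isUnit_one_sub

theorem ringJacobson_le_ker_of_surjective {R S : Type*} [Ring R] [Ring S] [IsSemisimpleRing S]
    (f : R →+* S) (hf : Function.Surjective f) : Ring.jacobson R ≤ RingHom.ker f := by
  have : RingHomSurjective f := ⟨hf⟩
  intro x hx
  have := Ring.le_comap_jacobson f hx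
  rw [IsSemisimpleRing.jacobson_eq_bot] at this
  exact this

section RadFiltration

variable {k : Type u} [Field k] {A : Type u} [Ring A] [Algebra k A]

theorem radFiltration_antitone : Antitone (radFiltration k A) :=
  fun _ _ h => Ideal.pow_le_pow_right h

theorem mem_radFiltration_one {x : A} : x ∈ radFiltration k A 1 ↔ x ∈ Ring.jacobson A := by
  change x ∈ Ring.jacobson A ^ 1 ↔ _
  rw [Submodule.pow_one]

theorem radFiltration_succ (n : ℕ) :
    radFiltration k A (n + 1) = radFiltration k A n * radFiltration k A 1 := by
  refine le_antisymm (fun x hx => ?_) ?_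
  · change x ∈ Ring.jacobson A ^ (n + 1) at hx
    rw [Submodule.pow_succ] at hx
    refine Submodule.mul_induction_on hx (fun y hy z hz => ?_) (fun y z => add_mem)
    exact Submodule.mul_mem_mul hy (mem_radFiltration_one.2 hz)
  · exact Submodule.mul_le.2 fun x hx y hy => radFiltration_mul_mem hx hy

theorem radFiltration_add (m n : ℕ) :
    radFiltration k A (m + n) = radFiltration k A m * radFiltration k A n := by
  induction n with
  | zero =>
    rw [radFiltration_zero]
    refine le_antisymm (fun x hx => ?_) ?_
    · simpa using Submodule.mul_mem_mul hx (Submodule.mem_top (R := k) (x := (1 : A)))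
    · exact Submodule.mul_le.2 fun x hx y _ => (Ring.jacobson A ^ m : Ideal A).mul_mem_right y hx
  | succ n ih => rw [← add_assoc, radFiltration_succ, ih, mul_assoc, ← radFiltration_succ]

theorem radClass_eq_radClass {n : ℕ} {x y : A} (hx : x ∈ radFiltration k A n)
    (hy : y ∈ radFiltration k A n) :
    radClass x hx = radClass y hy ↔ x - y ∈ radFiltration k A (n + 1) :=
  (Submodule.Quotient.eq _).trans Iff.rfl

theorem of_radClass_mul {m n : ℕ} {x y : A} (hx : x ∈ radFiltration k A m)
    (hy : y ∈ radFiltration k A n) :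
    DirectSum.of (RadPiece k A) m (radClass x hx) * DirectSum.of (RadPiece k A) n (radClass y hy) =
      DirectSum.of (RadPiece k A) (m + n) (radClass (x * y) (radFiltration_mul_mem hx hy)) :=
  DirectSum.of_mul_of _ _

end RadFiltration

/-! ### Tight gradings and the radical filtration -/

section Tight

open DirectSum

variable {k : Type u} [Field k] {A : Type u} [Ring A] [Algebra k A]

/-- The elements all of whose homogeneous components have degree at least `n`. -/
def gradedTail (𝒜 : ℕ → Submodule k A) [GradedAlgebra 𝒜] (n : ℕ) : Submodule k A where
  carrier := {x | ∀ i < n, (decompose 𝒜 x i : A) = 0}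
  add_mem' {x y} hx hy i hi := by
    rw [decompose_add, DirectSum.add_apply, Submodule.coe_add, hx i hi, hy i hi, add_zero]
  zero_mem' i _ := by rw [decompose_zero]; rfl
  smul_mem' c x hx i hi := by
    rw [decompose_smul, DirectSum.smul_apply, Submodule.coe_smul, hx i hi, smul_zero]

variable (𝒜 : ℕ → Submodule k A) [GradedAlgebra 𝒜]

theorem coe_decompose_mul_eq_sum (x y : A) (n : ℕ) :
    (decompose 𝒜 (x * y) n : A) =
      ∑ p ∈ Finset.HasAntidiagonal.antidiagonal n,
        (decompose 𝒜 x p.1 : A) * (decompose 𝒜 y p.2 : A) := by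
  rw [decompose_mul, coe_mul_apply_eq_sum_antidiagonal]

variable {𝒜}

theorem mem_gradedTail_of_mem {m n : ℕ} (h : n ≤ m) {x : A} (hx : x ∈ 𝒜 m) :
    x ∈ gradedTail 𝒜 n :=
  fun _ hi => decompose_of_mem_ne 𝒜 hx (hi.trans_le h).ne'

theorem gradedTail_mul_le (m n : ℕ) :
    gradedTail 𝒜 m * gradedTail 𝒜 n ≤ gradedTail 𝒜 (m + n) := by
  refine Submodule.mul_le.2 fun x hx y hy i hi => ?_
  rw [coe_decompose_mul_eq_sum]
  refine Finset.sum_eq_zero fun p hp => ?_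
  rw [Finset.HasAntidiagonal.mem_antidiagonal] at hp
  rcases lt_or_ge p.1 m with h | h
  · rw [hx _ h, zero_mul]
  · rw [hy p.2 (by omega), mul_zero]

theorem eq_zero_of_mem_of_mem_gradedTail {n : ℕ} {x : A} (hx : x ∈ 𝒜 n)
    (hx' : x ∈ gradedTail 𝒜 (n + 1)) : x = 0 :=
  (decompose_of_mem_same 𝒜 hx).symm.trans (hx' n n.lt_succ_self)

theorem sub_coe_decompose_mem_gradedTail {n : ℕ} {x : A} (hx : x ∈ gradedTail 𝒜 n) :
    x - decompose 𝒜 x n ∈ gradedTail 𝒜 (n + 1) := by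
  intro i hi
  rw [decompose_sub, DirectSum.sub_apply, AddSubgroupClass.coe_sub]
  rcases Nat.lt_succ_iff_lt_or_eq.1 hi with h | rfl
  · rw [hx i h, decompose_of_mem_ne 𝒜 (SetLike.coe_mem _) h.ne', sub_zero]
  · rw [decompose_of_mem_same 𝒜 (SetLike.coe_mem _), sub_self]

variable (𝒜) in
theorem exists_gradedTail_eq_bot [Module.Finite k A] : ∃ N, gradedTail 𝒜 N = ⊥ := by
  classical
  obtain ⟨s, hs⟩ := (Module.Finite.fg_top : (⊤ : Submodule k A).FG)
  obtain ⟨N, hN⟩ : ∃ N, ∀ x ∈ s, ∀ i, N ≤ i → (decompose 𝒜 x i : A) = 0 := by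
    refine ⟨(s.sup fun x => (decompose 𝒜 x).support.sup id) + 1, fun x hx i hi => ?_⟩
    by_contra h
    have h1 : i ∈ (decompose 𝒜 x).support :=
      DFinsupp.mem_support_iff.2 fun h0 => h (by rw [h0]; rfl)
    have h2 : i ≤ (decompose 𝒜 x).support.sup id := Finset.le_sup (f := id) h1
    have h3 := Finset.le_sup (f := fun x => (decompose 𝒜 x).support.sup id) hx
    simp only at h3
    omega
  have hN' : ∀ x : A, ∀ i, N ≤ i → (decompose 𝒜 x i : A) = 0 := by
    intro x i hi
    have hx : x ∈ Submodule.span k (s : Set A) := hs ▸ Submodule.mem_top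
    induction hx using Submodule.span_induction with
    | mem x hx => exact hN x hx i hi
    | zero => rw [decompose_zero]; rfl
    | add x y _ _ hx hy =>
      rw [decompose_add, DirectSum.add_apply, Submodule.coe_add, hx, hy, add_zero]
    | smul c x _ hx => rw [decompose_smul, DirectSum.smul_apply, Submodule.coe_smul, hx, smul_zero]
  refine ⟨N, (Submodule.eq_bot_iff _).2 fun x hx => ?_⟩
  rw [← sum_support_decompose 𝒜 x]
  exact Finset.sum_eq_zero fun i _ => (lt_or_ge i N).elim (hx i) (hN' x i)

theorem gradedTail_one_pow_le (n : ℕ) : gradedTail 𝒜 1 ^ n ≤ gradedTail 𝒜 n := by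
  induction n with
  | zero => exact fun x _ i hi => absurd hi i.not_lt_zero
  | succ n ih => exact (mul_le_mul_left ih _).trans (gradedTail_mul_le n 1)

theorem mem_ker_projZeroRingHom' {x : A} :
    x ∈ RingHom.ker (GradedRing.projZeroRingHom' 𝒜) ↔ x ∈ gradedTail 𝒜 1 := by
  rw [RingHom.mem_ker, ← Subtype.coe_inj]
  exact ⟨fun h i hi => by obtain rfl := Nat.lt_one_iff.1 hi; exact h, fun h => h 0 one_pos⟩

theorem radFiltration_one_eq_gradedTail [Module.Finite k A] [IsSemisimpleRing (𝒜 0)] :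
    radFiltration k A 1 = gradedTail 𝒜 1 := by
  refine le_antisymm (fun x hx => ?_) (fun x hx => ?_)
  · exact mem_ker_projZeroRingHom'.1 (ringJacobson_le_ker_of_surjective _
      (GradedRing.projZeroRingHom'_surjective 𝒜) (mem_radFiltration_one.1 hx))
  · refine mem_radFiltration_one.2 (le_ringJacobson_of_forall_isNilpotent
      (RingHom.ker (GradedRing.projZeroRingHom' 𝒜)) (fun y hy => ?_)
      (mem_ker_projZeroRingHom'.2 hx))
    obtain ⟨N, hN⟩ := exists_gradedTail_eq_bot 𝒜
    refine ⟨N, (Submodule.mem_bot k).1 (hN ▸ gradedTail_one_pow_le N ?_)⟩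
    exact Submodule.pow_mem_pow _ (mem_ker_projZeroRingHom'.1 hy) N

/-- For a tight grading, the powers of the radical are the tails of the grading. -/
theorem radFiltration_eq_gradedTail [Module.Finite k A] [IsSemisimpleRing (𝒜 0)]
    (hgen : Algebra.adjoin k ((𝒜 0 : Set A) ∪ (𝒜 1 : Set A)) = ⊤) (n : ℕ) :
    radFiltration k A n = gradedTail 𝒜 n := by
  refine le_antisymm ?_ fun x hx => ?_
  · induction n with
    | zero => exact fun x _ i hi => absurd hi i.not_lt_zero
    | succ n ih =>
      rw [radFiltration_succ, radFiltration_one_eq_gradedTail (𝒜 := 𝒜)]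
      exact (mul_le_mul_left ih _).trans (gradedTail_mul_le n 1)
  · -- The elements whose component in each degree `i` lies in `radⁱ A` form a subalgebra.
    have key : ∀ y : A, ∀ i, (decompose 𝒜 y i : A) ∈ radFiltration k A i := by
      intro y
      have hy : y ∈ Algebra.adjoin k ((𝒜 0 : Set A) ∪ (𝒜 1 : Set A)) := hgen ▸ Algebra.mem_top
      have aux : ∀ m, (∀ z ∈ 𝒜 m, z ∈ radFiltration k A m) → ∀ z ∈ 𝒜 m, ∀ i,
          (decompose 𝒜 z i : A) ∈ radFiltration k A i := by
        intro m hm z hz i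
        rcases eq_or_ne m i with rfl | h
        · rw [decompose_of_mem_same 𝒜 hz]
          exact hm z hz
        · rw [decompose_of_mem_ne 𝒜 hz h]
          exact zero_mem _
      have aux0 := aux 0 fun z _ => radFiltration_zero k A ▸ Submodule.mem_top
      induction hy using Algebra.adjoin_induction with
      | mem y hy =>
        rcases hy with hy | hy
        · exact aux0 y hy
        · refine aux 1 (fun z hz => ?_) y hy
          rw [radFiltration_one_eq_gradedTail (𝒜 := 𝒜)]
          exact mem_gradedTail_of_mem le_rfl hz
      | algebraMap c => exact aux0 _ (SetLike.algebraMap_mem_graded 𝒜 c)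
      | add y z _ _ hy hz =>
        intro i
        rw [decompose_add, DirectSum.add_apply, Submodule.coe_add]
        exact add_mem (hy i) (hz i)
      | mul y z _ _ hy hz =>
        intro i
        rw [coe_decompose_mul_eq_sum]
        refine sum_mem fun p hp => ?_
        rw [← Finset.HasAntidiagonal.mem_antidiagonal.1 hp]
        exact radFiltration_mul_mem (hy _) (hz _)
    classical
    rw [← sum_support_decompose 𝒜 x]
    refine sum_mem fun i _ => ?_
    rcases lt_or_ge i n with h | h
    · rw [hx i h]
      exact zero_mem _
    · exact radFiltration_antitone h (key x i)

/-- For a tight grading, an element `x` of `radⁿ A` that multiplies the radical two steps down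
can be corrected, modulo `radⁿ⁺¹ A`, to an element `y` that annihilates the radical: `y` is the
homogeneous component of degree `n` of `x`. -/
theorem exists_sub_mem_radFiltration_and_mul_eq_zero [Module.Finite k A] (h : HasTightGrading k A)
    {n : ℕ} {x : A} (hx : x ∈ radFiltration k A n)
    (hx' : ∀ j ∈ radFiltration k A 1, x * j ∈ radFiltration k A (n + 2)) :
    ∃ y : A, x - y ∈ radFiltration k A (n + 1) ∧ ∀ j ∈ radFiltration k A 1, y * j = 0 := by
  classical
  obtain ⟨𝒜, _, hss, hgen⟩ := h
  have hF := radFiltration_eq_gradedTail hgen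
  have hxy : x - decompose 𝒜 x n ∈ radFiltration k A (n + 1) := by
    rw [hF] at hx ⊢
    exact sub_coe_decompose_mem_gradedTail hx
  refine ⟨decompose 𝒜 x n, hxy, fun j hj => ?_⟩
  -- On the component of degree `m + 1` of `j`, both `x * j` and `(x - y) * j` lie in
  -- `radⁿ⁺ᵐ⁺² A`, whereas `y * j` is homogeneous of degree `n + m + 1`, and so it vanishes.
  have hxm : ∀ m, ∀ j ∈ radFiltration k A (m + 1), x * j ∈ radFiltration k A (n + (m + 1) + 1) := by
    intro m j hj
    rw [add_comm m 1, radFiltration_add] at hj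
    refine Submodule.mul_induction_on hj (fun a ha b hb => ?_) fun a b ha hb => ?_
    · rw [← mul_assoc, show n + (m + 1) + 1 = n + 2 + m by omega]
      exact radFiltration_mul_mem (hx' a ha) hb
    · rw [mul_add]
      exact add_mem ha hb
  rw [← sum_support_decompose 𝒜 j, Finset.mul_sum]
  refine Finset.sum_eq_zero fun i _ => ?_
  rcases i with _ | m
  · rw [hF] at hj
    rw [hj 0 one_pos, mul_zero]
  · have hjm : (decompose 𝒜 j (m + 1) : A) ∈ radFiltration k A (m + 1) := by
      rw [hF]
      exact mem_gradedTail_of_mem le_rfl (SetLike.coe_mem _)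
    refine eq_zero_of_mem_of_mem_gradedTail (n := n + (m + 1))
      (SetLike.mul_mem_graded (SetLike.coe_mem _) (SetLike.coe_mem _)) ?_
    rw [← hF]
    have hd := radFiltration_mul_mem hxy hjm
    rw [add_right_comm n 1 (m + 1)] at hd
    have := sub_mem (hxm m _ hjm) hd
    rwa [sub_mul, sub_sub_cancel] at this

end Tight

section TightEquiv

open DirectSum

variable {k : Type u} [Field k] {A : Type u} [Ring A] [Algebra k A]

/-- A tight grading identifies `A` with `gr A`: an element is sent to the family of the classes of
its homogeneous components. -/
theorem HasTightGrading.isTightlyGraded [Module.Finite k A] (h : HasTightGrading k A) :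
    IsTightlyGraded k A := by
  classical
  obtain ⟨𝒜, _, hss, hgen⟩ := h
  have hF := radFiltration_eq_gradedTail hgen
  have hmem : ∀ {i : ℕ} {x : A}, x ∈ 𝒜 i → x ∈ radFiltration k A i := fun {i x} hx => by
    rw [hF]
    exact mem_gradedTail_of_mem le_rfl hx
  let φ : ∀ i, 𝒜 i →ₗ[k] RadGraded k A := fun i =>
    (lof k ℕ (RadPiece k A) i).comp
      ({ toFun := fun x => radClass x.1 (hmem x.2)
         map_add' := fun _ _ => rfl
         map_smul' := fun _ _ => rfl } : 𝒜 i →ₗ[k] RadPiece k A i)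
  let Φ : (⨁ i, 𝒜 i) →ₐ[k] RadGraded k A :=
    DirectSum.toAlgebra k (fun i => 𝒜 i) φ rfl fun {i j} x y =>
      (of_radClass_mul (hmem x.2) (hmem y.2)).symm
  have hΦ : ∀ i (x : 𝒜 i), Φ (of (fun i => 𝒜 i) i x) = of _ i (radClass x.1 (hmem x.2)) :=
    fun i x => DirectSum.toAddMonoid_of (fun i => (φ i).toAddMonoidHom) i x
  have hΦi : ∀ (z : ⨁ i, 𝒜 i) (i : ℕ), Φ z i = radClass (z i : A) (hmem (z i).2) := by
    intro z i
    induction z using DirectSum.induction_on with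
    | zero => rw [map_zero]; rfl
    | of j x =>
      rw [hΦ]
      rcases eq_or_ne j i with rfl | hij
      · rw [of_eq_same]
        congr 1
        rw [of_eq_same]
      · rw [of_eq_of_ne _ _ _ hij.symm]
        refine (radClass_eq_zero _ ?_).symm
        rw [of_eq_of_ne _ _ _ hij.symm]
        exact zero_mem _
    | add z w hz hw => rw [map_add, DirectSum.add_apply, hz, hw]; rfl
  have hinj : Function.Injective Φ := by
    refine fun z w hzw => DFinsupp.ext fun i => Subtype.ext ?_
    have h0 : radClass (z i : A) (hmem (z i).2) = radClass (w i : A) (hmem (w i).2) := by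
      rw [← hΦi, ← hΦi, hzw]
    rw [radClass_eq_radClass, hF] at h0
    exact sub_eq_zero.1 (eq_zero_of_mem_of_mem_gradedTail (sub_mem (z i).2 (w i).2) h0)
  have hsurj : Function.Surjective Φ := by
    intro w
    induction w using DirectSum.induction_on with
    | zero => exact ⟨0, map_zero _⟩
    | of i a =>
      obtain ⟨x, hx, rfl⟩ := exists_radClass a
      refine ⟨of _ i (decompose 𝒜 x i), ?_⟩
      rw [hΦ]
      congr 1
      rw [eq_comm, radClass_eq_radClass]
      rw [hF] at hx ⊢
      exact sub_coe_decompose_mem_gradedTail hx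
    | add z w hz hw =>
      obtain ⟨z', rfl⟩ := hz
      obtain ⟨w', rfl⟩ := hw
      exact ⟨z' + w', map_add _ _ _⟩
  exact ⟨(decomposeAlgEquiv 𝒜).trans (AlgEquiv.ofBijective Φ ⟨hinj, hsurj⟩)⟩

/-- The algebra `gr A` is generated by its components of degrees `0` and `1`. -/
theorem of_radClass_mem_adjoin (n : ℕ) (x : A) (hx : x ∈ radFiltration k A n) :
    of (RadPiece k A) n (radClass x hx) ∈ Algebra.adjoin k
      (Set.range (of (RadPiece k A) 0) ∪ Set.range (of (RadPiece k A) 1)) := by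
  induction n generalizing x with
  | zero => exact Algebra.subset_adjoin (Or.inl ⟨_, rfl⟩)
  | succ n ih =>
    have hx' := hx
    rw [radFiltration_succ] at hx'
    induction hx' using Submodule.mul_induction_on' with
    | mem_mul_mem y hy z hz =>
      rw [← of_radClass_mul hy hz]
      exact mul_mem (ih y hy) (Algebra.subset_adjoin (Or.inr ⟨_, rfl⟩))
    | add y hy z hz hy' hz' =>
      rw [← radFiltration_succ] at hy hz
      have := add_mem (hy' hy) (hz' hz)
      rwa [← map_add] at this

/-- The grading of `gr A`, transported along an isomorphism `A ≅ gr A`, is tight. -/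
theorem IsTightlyGraded.hasTightGrading [Module.Finite k A] (h : IsTightlyGraded k A) :
    HasTightGrading k A := by
  classical
  obtain ⟨e⟩ := h
  let ψ : ∀ i, RadPiece k A i →ₗ[k] A := fun i =>
    e.symm.toLinearMap.comp (lof k ℕ (RadPiece k A) i)
  have hψ : ∀ i a, e (ψ i a) = of _ i a := fun i a => e.apply_symm_apply _
  let 𝒜 : ℕ → Submodule k A := fun i => LinearMap.range (ψ i)
  have hone : (1 : A) = ψ 0 (radClassZero k A 1) := (map_one e.symm).symm
  have hmul : ∀ {m n : ℕ} (a : RadPiece k A m) (b : RadPiece k A n),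
      ψ m a * ψ n b = ψ (m + n) (GradedMonoid.GMul.mul a b) := fun {m n} a b => by
    apply e.injective
    rw [map_mul, hψ, hψ, hψ, of_mul_of]
  have hgm : SetLike.GradedMonoid 𝒜 :=
    { one_mem := ⟨_, hone.symm⟩
      mul_mem := by
        rintro m n _ _ ⟨a, rfl⟩ ⟨b, rfl⟩
        exact ⟨_, (hmul a b).symm⟩ }
  let D : A →ₗ[k] ⨁ i, 𝒜 i :=
    (DFinsupp.mapRange.linearMap fun i => (ψ i).rangeRestrict).comp e.toLinearMap
  have hD : ∀ i a, D (ψ i a) = of (fun i => 𝒜 i) i ⟨ψ i a, a, rfl⟩ := by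
    intro i a
    change DFinsupp.mapRange.linearMap (fun i => (ψ i).rangeRestrict) (e (ψ i a)) = _
    rw [hψ]
    exact DFinsupp.mapRange_single (hf := fun _ => map_zero _)
  let dec : DirectSum.Decomposition 𝒜 :=
    { decompose' := D
      left_inv := by
        intro x
        obtain ⟨w, rfl⟩ := e.symm.surjective x
        induction w using DirectSum.induction_on with
        | zero => rw [map_zero, map_zero, map_zero]
        | of i a =>
          change DirectSum.coeAddMonoidHom 𝒜 (D (ψ i a)) = _
          rw [hD, DirectSum.coeAddMonoidHom_of]
          rfl
        | add z w hz hw => rw [map_add, map_add, map_add, hz, hw]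
      right_inv := by
        intro z
        induction z using DirectSum.induction_on with
        | zero => rw [map_zero, map_zero]
        | of i x =>
          obtain ⟨_, a, rfl⟩ := x
          rw [DirectSum.coeAddMonoidHom_of]
          exact hD i a
        | add z w hz hw => rw [map_add, map_add, hz, hw] }
  let gr : GradedAlgebra 𝒜 := { hgm, dec with }
  refine ⟨𝒜, gr, ?_, ?_⟩
  · have : IsArtinianRing A := isArtinian_of_tower k inferInstance
    have : IsSemisimpleRing (A ⧸ Ring.jacobson A) := IsSemiprimaryRing.isSemisimpleRing
    let g : A →+* 𝒜 0 :=
      { toFun := fun x => ⟨ψ 0 (radClassZero k A x), _, rfl⟩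
        map_one' := Subtype.ext hone.symm
        map_zero' := Subtype.ext (by simp)
        map_add' := fun x y => Subtype.ext (by simp)
        map_mul' := fun x y => Subtype.ext (hmul (radClassZero k A x) (radClassZero k A y)).symm }
    refine RingHom.isSemisimpleRing_of_surjective
      (Ideal.Quotient.lift (Ring.jacobson A) g fun x hx => Subtype.ext ?_) ?_
    · have h0 : radClassZero k A x = 0 := radClass_eq_zero _ (mem_radFiltration_one.2 hx)
      change ψ 0 (radClassZero k A x) = 0
      rw [h0, map_zero]
    · refine Ideal.Quotient.lift_surjective_of_surjective _ _ ?_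
      rintro ⟨_, a, rfl⟩
      obtain ⟨x, hx, rfl⟩ := exists_radClass a
      exact ⟨x, rfl⟩
  · have hset : e.symm.toAlgHom '' (Set.range (of (RadPiece k A) 0) ∪
        Set.range (of (RadPiece k A) 1)) = (𝒜 0 : Set A) ∪ 𝒜 1 := by
      rw [Set.image_union, ← Set.range_comp, ← Set.range_comp]
      rfl
    rw [← hset, ← AlgHom.map_adjoin, eq_top_iff]
    rintro x -
    refine ⟨e x, ?_, e.symm_apply_apply x⟩
    generalize e x = w
    induction w using DirectSum.induction_on with
    | zero => exact zero_mem _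
    | of i a =>
      obtain ⟨x, hx, rfl⟩ := exists_radClass a
      exact of_radClass_mem_adjoin i x hx
    | add z w hz hw => exact add_mem hz hw

theorem isTightlyGraded_iff_hasTightGrading [Module.Finite k A] :
    IsTightlyGraded k A ↔ HasTightGrading k A :=
  ⟨IsTightlyGraded.hasTightGrading, HasTightGrading.isTightlyGraded⟩

end TightEquiv

/-! ### Algebras given by quivers with relations -/

/-- A family of elements of a `k`-algebra satisfying the defining relations of the path algebra of
a quiver: elements `e v` for the vertices and `x f` for the arrows. -/
structure IsPathFamily {V : Type} [Fintype V] [Quiver.{0} V] {B : Type*} [Ring B]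
    (e : V → B) (x : Quiver.Total V → B) : Prop where
  idem : ∀ v, e v * e v = e v
  orth : ∀ v w, v ≠ w → e v * e w = 0
  sum_one : ∑ v, e v = 1
  source : ∀ f : Quiver.Total V, e f.left * x f = x f
  target : ∀ f : Quiver.Total V, x f * e f.right = x f

section Lift

variable {k : Type u} [Field k]

variable (k) in
/-- The projection from the free algebra on the vertices and arrows to the path algebra. -/
noncomputable def PathAlgebra.ofFreeAlgebra (V : Type) [Fintype V] [Quiver.{0} V] :
    FreeAlgebra k (V ⊕ Quiver.Total V) →ₐ[k] PathAlgebra k V :=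
  RingQuot.mkAlgHom k (PathRel k V)

theorem PathAlgebra.ofFreeAlgebra_surjective (V : Type) [Fintype V] [Quiver.{0} V] :
    Function.Surjective (PathAlgebra.ofFreeAlgebra k V) :=
  RingQuot.mkAlgHom_surjective k _

/-- The universal property of the path algebra. -/
noncomputable def PathAlgebra.lift {V : Type} [Fintype V] [Quiver.{0} V] {B : Type*} [Ring B]
    [Algebra k B] {e : V → B} {x : Quiver.Total V → B} (h : IsPathFamily e x) :
    PathAlgebra k V →ₐ[k] B :=
  RingQuot.liftAlgHom k ⟨FreeAlgebra.lift k (Sum.elim e x), by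
    intro a b hab
    cases hab with
    | idem v => simpa using h.idem v
    | orth v w hvw => simpa using h.orth v w hvw
    | sum_one => simpa using h.sum_one
    | source f => simpa using h.source f
    | target f => simpa using h.target f⟩

section

variable {V : Type} [Fintype V] [Quiver.{0} V] {B : Type*} [Ring B]
    [Algebra k B] {e : V → B} {x : Quiver.Total V → B} (h : IsPathFamily e x)

@[simp]
theorem PathAlgebra.lift_vertex (v : V) :
    PathAlgebra.lift h (PathAlgebra.vertex k v) = e v :=
  (RingQuot.liftAlgHom_mkAlgHom_apply _ _ _ _).trans (by simp)

@[simp]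
theorem PathAlgebra.lift_arrow {v w : V} (f : v ⟶ w) :
    PathAlgebra.lift h (PathAlgebra.arrow k f) = x ⟨v, w, f⟩ :=
  (RingQuot.liftAlgHom_mkAlgHom_apply _ _ _ _).trans (by simp)

end

theorem PathAlgebra.isPathFamily (V : Type) [Fintype V] [Quiver.{0} V] :
    IsPathFamily (PathAlgebra.vertex k (V := V)) (fun f => PathAlgebra.arrow k f.hom) where
  idem v := by
    have := RingQuot.mkAlgHom_rel k (PathRel.idem (k := k) v)
    rwa [map_mul] at this
  orth v w hvw := by
    have := RingQuot.mkAlgHom_rel k (PathRel.orth (k := k) v w hvw)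
    rwa [map_mul, map_zero] at this
  sum_one := by
    have := RingQuot.mkAlgHom_rel k (PathRel.sum_one (k := k) (V := V))
    rwa [map_sum, map_one] at this
  source f := by
    have := RingQuot.mkAlgHom_rel k (PathRel.source (k := k) f)
    rwa [map_mul] at this
  target f := by
    have := RingQuot.mkAlgHom_rel k (PathRel.target (k := k) f)
    rwa [map_mul] at this

theorem PathAlgebra.adjoin_eq_top (V : Type) [Fintype V] [Quiver.{0} V] :
    Algebra.adjoin k (Set.range (PathAlgebra.vertex k (V := V)) ∪
      Set.range fun f : Quiver.Total V => PathAlgebra.arrow k f.hom) = ⊤ := by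
  have h : Set.range (PathAlgebra.vertex k (V := V)) ∪
      Set.range (fun f : Quiver.Total V => PathAlgebra.arrow k f.hom) =
      (PathAlgebra.ofFreeAlgebra k V) '' Set.range (FreeAlgebra.ι k) := by
    rw [← Set.range_comp, ← Sum.elim_comp_inl_inr (_ ∘ FreeAlgebra.ι k), Set.Sum.elim_range]
    rfl
  rw [h, ← AlgHom.map_adjoin, FreeAlgebra.adjoin_range_ι, Algebra.map_top, AlgHom.range_eq_top]
  exact PathAlgebra.ofFreeAlgebra_surjective V

namespace QuiverWithRelations

variable (Q : QuiverWithRelations k)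

/-- The projection `kQ → kQ / I`. -/
noncomputable def proj : PathAlgebra k Q.V →ₐ[k] Q.QuotAlgebra :=
  RingQuot.mkAlgHom k Q.rel

/-- The class of a trivial path in `kQ / I`. -/
noncomputable def vertex (v : Q.V) : Q.QuotAlgebra :=
  Q.proj (PathAlgebra.vertex k v)

/-- The class of an arrow in `kQ / I`. -/
noncomputable def arrow (f : Quiver.Total Q.V) : Q.QuotAlgebra :=
  Q.proj (PathAlgebra.arrow k f.hom)

variable {Q}

theorem proj_eq_of_rel {a b : PathAlgebra k Q.V} (h : Q.rel a b) : Q.proj a = Q.proj b :=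
  RingQuot.mkAlgHom_rel k h

variable (Q) in
theorem isPathFamily : IsPathFamily Q.vertex Q.arrow where
  idem v := by
    rw [vertex, ← map_mul, (PathAlgebra.isPathFamily Q.V).idem]
  orth v w hvw := by
    rw [vertex, vertex, ← map_mul, (PathAlgebra.isPathFamily Q.V).orth v w hvw, map_zero]
  sum_one := by
    simp only [vertex]
    rw [← map_sum, (PathAlgebra.isPathFamily Q.V).sum_one, map_one]
  source f := by
    rw [vertex, arrow, ← map_mul, (PathAlgebra.isPathFamily Q.V).source f]
  target f := by
    rw [vertex, arrow, ← map_mul, (PathAlgebra.isPathFamily Q.V).target f]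

variable (Q) in
theorem adjoin_eq_top :
    Algebra.adjoin k (Set.range Q.vertex ∪ Set.range Q.arrow) = ⊤ := by
  have h : Set.range Q.vertex ∪ Set.range Q.arrow =
      Q.proj '' (Set.range (PathAlgebra.vertex k (V := Q.V)) ∪
        Set.range fun f : Quiver.Total Q.V => PathAlgebra.arrow k f.hom) := by
    rw [Set.image_union, ← Set.range_comp, ← Set.range_comp]
    rfl
  rw [h, ← AlgHom.map_adjoin, PathAlgebra.adjoin_eq_top, Algebra.map_top, AlgHom.range_eq_top]
  exact RingQuot.mkAlgHom_surjective k _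

/-- The universal property of `kQ / I`. -/
noncomputable def lift {B : Type*} [Ring B] [Algebra k B] (F : PathAlgebra k Q.V →ₐ[k] B)
    (h : ∀ a b, Q.rel a b → F a = F b) : Q.QuotAlgebra →ₐ[k] B :=
  RingQuot.liftAlgHom k ⟨F, fun a b => h a b⟩

@[simp]
theorem lift_proj {B : Type*} [Ring B] [Algebra k B] (F : PathAlgebra k Q.V →ₐ[k] B)
    (h : ∀ a b, Q.rel a b → F a = F b) (a : PathAlgebra k Q.V) :
    lift F h (Q.proj a) = F a :=
  RingQuot.liftAlgHom_mkAlgHom_apply _ _ _ _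

end QuiverWithRelations

end Lift

/-! ### The ideal generated by the arrows -/

theorem Submodule.le_mul_top {k : Type u} [Field k] {A : Type u} [Ring A] [Algebra k A]
    (T : Submodule k A) : T ≤ T * ⊤ := fun t ht => by
  simpa using Submodule.mul_mem_mul ht (Submodule.mem_top (R := k) (x := (1 : A)))

theorem Submodule.le_top_mul {k : Type u} [Field k] {A : Type u} [Ring A] [Algebra k A]
    (T : Submodule k A) : T ≤ ⊤ * T := fun t ht => by
  simpa using Submodule.mul_mem_mul (Submodule.mem_top (R := k) (x := (1 : A))) ht

namespace IsPathFamily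

variable {k : Type u} [Field k] {A : Type u} [Ring A] [Algebra k A]
  {V : Type} [Fintype V] [Quiver.{0} V] {e : V → A} {x : Quiver.Total V → A}

theorem span_vertex_mul_le (h : IsPathFamily e x) :
    Submodule.span k (Set.range e) * Submodule.span k (Set.range e) ≤
      Submodule.span k (Set.range e) := by
  rw [Submodule.span_mul_span, Submodule.span_le]
  rintro _ ⟨_, ⟨v, rfl⟩, _, ⟨w, rfl⟩, rfl⟩
  rcases eq_or_ne v w with rfl | hvw
  · change e v * e v ∈ _
    rw [h.idem]
    exact Submodule.subset_span ⟨v, rfl⟩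
  · simp [h.orth v w hvw]

theorem one_mem_span_vertex (h : IsPathFamily e x) : (1 : A) ∈ Submodule.span k (Set.range e) :=
  h.sum_one ▸ sum_mem fun v _ => Submodule.subset_span ⟨v, rfl⟩

theorem vertex_mul_mem (h : IsPathFamily e x) (v : V) {t : A}
    (ht : t ∈ Submodule.span k (Set.range x)) : e v * t ∈ Submodule.span k (Set.range x) := by
  induction ht using Submodule.span_induction with
  | mem t ht =>
    obtain ⟨f, rfl⟩ := ht
    rcases eq_or_ne v f.left with rfl | hv
    · rw [h.source]
      exact Submodule.subset_span ⟨f, rfl⟩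
    · rw [← h.source, ← mul_assoc, h.orth _ _ hv, zero_mul]
      exact zero_mem _
  | zero => simp
  | add a b _ _ ha hb => rw [mul_add]; exact add_mem ha hb
  | smul c a _ ha => rw [mul_smul_comm]; exact Submodule.smul_mem _ c ha

theorem mul_vertex_mem (h : IsPathFamily e x) (v : V) {t : A}
    (ht : t ∈ Submodule.span k (Set.range x)) : t * e v ∈ Submodule.span k (Set.range x) := by
  induction ht using Submodule.span_induction with
  | mem t ht =>
    obtain ⟨f, rfl⟩ := ht
    rcases eq_or_ne f.right v with rfl | hv
    · rw [h.target]
      exact Submodule.subset_span ⟨f, rfl⟩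
    · rw [← h.target, mul_assoc, h.orth _ _ hv, mul_zero]
      exact zero_mem _
  | zero => simp
  | add a b _ _ ha hb => rw [add_mul]; exact add_mem ha hb
  | smul c a _ ha => rw [smul_mul_assoc]; exact Submodule.smul_mem _ c ha

theorem mul_eq_zero (h : IsPathFamily e x) {f g : Quiver.Total V} (hfg : f.right ≠ g.left) :
    x f * x g = 0 := by
  rw [← h.target f, ← h.source g, mul_assoc, ← mul_assoc (e _) (e _), h.orth _ _ hfg, zero_mul,
    mul_zero]

/-- The left ideal and the right ideal generated by the arrows coincide, since multiplication by a
vertex maps the span of the arrows to itself. -/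
theorem top_mul_eq_mul_top (h : IsPathFamily e x)
    (hgen : Algebra.adjoin k (Set.range e ∪ Set.range x) = ⊤) :
    ⊤ * Submodule.span k (Set.range x) = Submodule.span k (Set.range x) * ⊤ := by
  set T := Submodule.span k (Set.range x) with hT
  have hTT : T * ⊤ * ⊤ ≤ T * ⊤ := by
    rw [mul_assoc]
    exact mul_le_mul_right le_top _
  have hTT' : ⊤ * (⊤ * T) ≤ ⊤ * T := by
    rw [← mul_assoc]
    exact mul_le_mul_left le_top _
  refine le_antisymm (Submodule.mul_le.2 fun a _ => ?_) (Submodule.mul_le.2 fun t ht a _ => ?_)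
  · have ha : a ∈ Algebra.adjoin k (Set.range e ∪ Set.range x) := hgen ▸ Algebra.mem_top
    induction ha using Algebra.adjoin_induction with
    | mem a ha =>
      intro t ht
      rcases ha with ⟨v, rfl⟩ | ⟨f, rfl⟩
      · exact Submodule.le_mul_top T (h.vertex_mul_mem v ht)
      · exact Submodule.mul_mem_mul (Submodule.subset_span ⟨f, rfl⟩) Submodule.mem_top
    | algebraMap c =>
      intro t ht
      rw [← Algebra.smul_def]
      exact Submodule.le_mul_top T (Submodule.smul_mem _ c ht)
    | add a b _ _ ha hb =>
      intro t ht
      rw [add_mul]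
      exact add_mem (ha trivial t ht) (hb trivial t ht)
    | mul a b _ _ ha hb =>
      intro t ht
      rw [mul_assoc]
      refine Submodule.mul_induction_on (hb trivial t ht) (fun s hs c _ => ?_) fun y z hy hz => ?_
      · rw [← mul_assoc]
        exact hTT (Submodule.mul_mem_mul (ha trivial s hs) Submodule.mem_top)
      · rw [mul_add]
        exact add_mem hy hz
  · have ha : a ∈ Algebra.adjoin k (Set.range e ∪ Set.range x) := hgen ▸ Algebra.mem_top
    induction ha using Algebra.adjoin_induction generalizing t with
    | mem a ha =>
      rcases ha with ⟨v, rfl⟩ | ⟨f, rfl⟩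
      · exact Submodule.le_top_mul T (h.mul_vertex_mem v ht)
      · exact Submodule.mul_mem_mul Submodule.mem_top (Submodule.subset_span ⟨f, rfl⟩)
    | algebraMap c =>
      rw [← Algebra.commutes, ← Algebra.smul_def]
      exact Submodule.le_top_mul T (Submodule.smul_mem _ c ht)
    | add a b _ _ ha hb =>
      rw [mul_add]
      exact add_mem (ha t ht trivial) (hb t ht trivial)
    | mul a b _ _ ha hb =>
      rw [← mul_assoc]
      refine Submodule.mul_induction_on (ha t ht trivial) (fun c _ s hs => ?_) fun y z hy hz => ?_
      · rw [mul_assoc]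
        exact hTT' (Submodule.mul_mem_mul Submodule.mem_top (hb s hs trivial))
      · rw [add_mul]
        exact add_mem hy hz

theorem top_mul_pow (h : IsPathFamily e x)
    (hgen : Algebra.adjoin k (Set.range e ∪ Set.range x) = ⊤) (n : ℕ) :
    ⊤ * Submodule.span k (Set.range x) ^ n * (⊤ * Submodule.span k (Set.range x)) =
      ⊤ * Submodule.span k (Set.range x) ^ (n + 1) := by
  have hc : Commute (⊤ : Submodule k A) (Submodule.span k (Set.range x)) :=
    h.top_mul_eq_mul_top hgen
  have htop : (⊤ : Submodule k A) * ⊤ = ⊤ := top_le_iff.1 (Submodule.le_mul_top ⊤)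
  rw [mul_assoc, ← mul_assoc (_ ^ n) ⊤, ← (hc.pow_right n).eq, mul_assoc ⊤ (_ ^ n), ← pow_succ,
    ← mul_assoc, htop]

/-- The algebra is spanned by the vertices and the ideal generated by the arrows. -/
theorem span_vertex_sup_eq_top (h : IsPathFamily e x)
    (hgen : Algebra.adjoin k (Set.range e ∪ Set.range x) = ⊤) :
    Submodule.span k (Set.range e) ⊔ ⊤ * Submodule.span k (Set.range x) = ⊤ := by
  set T := Submodule.span k (Set.range x) with hT
  set E := Submodule.span k (Set.range e) with hE
  rw [eq_top_iff]
  rintro a -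
  have ha : a ∈ Algebra.adjoin k (Set.range e ∪ Set.range x) := hgen ▸ Algebra.mem_top
  induction ha using Algebra.adjoin_induction with
  | mem a ha =>
    rcases ha with ha | ha
    · exact Submodule.mem_sup_left (Submodule.subset_span ha)
    · exact Submodule.mem_sup_right (Submodule.le_top_mul T (Submodule.subset_span ha))
  | algebraMap c =>
    rw [Algebra.algebraMap_eq_smul_one]
    exact Submodule.mem_sup_left (Submodule.smul_mem _ c h.one_mem_span_vertex)
  | add a b _ _ ha hb => exact add_mem ha hb
  | mul a b _ _ ha hb =>
    refine (?_ : (E ⊔ ⊤ * T) * (E ⊔ ⊤ * T) ≤ E ⊔ ⊤ * T) (Submodule.mul_mem_mul ha hb)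
    have h1 : ∀ S : Submodule k A, S * (⊤ * T) ≤ ⊤ * T := fun S => by
      rw [← mul_assoc]
      exact mul_le_mul_left le_top _
    have h2 : ∀ S : Submodule k A, ⊤ * T * S ≤ ⊤ * T := fun S => by
      rw [h.top_mul_eq_mul_top hgen, mul_assoc]
      exact mul_le_mul_right le_top _
    rw [Submodule.sup_mul, Submodule.mul_sup]
    exact sup_le (sup_le (h.span_vertex_mul_le.trans le_sup_left) ((h1 _).trans le_sup_right))
      ((h2 _).trans le_sup_right)

/-- If the ideal generated by finitely many arrows is nilpotent, then the algebra is
finite dimensional. -/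
theorem finite_of_pow_eq_bot [Finite (Quiver.Total V)] (h : IsPathFamily e x)
    (hgen : Algebra.adjoin k (Set.range e ∪ Set.range x) = ⊤) {N : ℕ}
    (hN : Submodule.span k (Set.range x) ^ N = ⊥) : Module.Finite k A := by
  set T := Submodule.span k (Set.range x) with hT
  set E := Submodule.span k (Set.range e) with hE
  have hTfg : T.FG := Submodule.fg_span (Set.finite_range x)
  have hEfg : E.FG := Submodule.fg_span (Set.finite_range e)
  -- Modulo the left ideal generated by the paths of length `n`, the algebra is spanned by the
  -- finitely many paths of smaller length.
  have key : ∀ n, ∃ W : Submodule k A, W.FG ∧ W ⊔ ⊤ * T ^ n = ⊤ := by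
    intro n
    induction n with
    | zero => exact ⟨⊥, Submodule.fg_bot, by simp⟩
    | succ n ih =>
      obtain ⟨W, hW, hWn⟩ := ih
      refine ⟨W ⊔ E * T ^ n, hW.sup (hEfg.mul (hTfg.pow n)), ?_⟩
      rw [sup_assoc, pow_succ', ← mul_assoc, ← Submodule.sup_mul, h.span_vertex_sup_eq_top hgen,
        hWn]
  obtain ⟨W, hW, hWN⟩ := key N
  rw [hN, Submodule.mul_bot, sup_bot_eq] at hWN
  exact ⟨hWN ▸ hW⟩

/-- If the ideal generated by the arrows is nilpotent, then it is the Jacobson radical, and its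
powers are the terms of the radical filtration. -/
theorem radFiltration_eq [Finite (Quiver.Total V)] (h : IsPathFamily e x)
    (hgen : Algebra.adjoin k (Set.range e ∪ Set.range x) = ⊤) {N : ℕ}
    (hN : Submodule.span k (Set.range x) ^ N = ⊥) (n : ℕ) :
    radFiltration k A n = ⊤ * Submodule.span k (Set.range x) ^ n := by
  have hfin := h.finite_of_pow_eq_bot hgen hN
  have hart : IsArtinianRing A := isArtinian_of_tower k inferInstance
  set T := Submodule.span k (Set.range x) with hT
  have hle : ⊤ * T ≤ radFiltration k A 1 := by
    have hspan : ∀ y ∈ Ideal.span (Set.range x), y ∈ ⊤ * T := by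
      intro y hy
      induction hy using Submodule.span_induction with
      | mem y hy => exact Submodule.le_top_mul T (Submodule.subset_span hy)
      | zero => exact zero_mem _
      | add y z _ _ hy hz => exact add_mem hy hz
      | smul a y _ hy =>
        have := Submodule.mul_mem_mul (Submodule.mem_top (R := k) (x := a)) hy
        rw [← mul_assoc] at this
        exact mul_le_mul_left (le_top (a := (⊤ : Submodule k A) * ⊤)) T this
    have hpow : ∀ n, (⊤ * T) ^ n ≤ ⊤ * T ^ n := by
      intro n
      induction n with
      | zero => simp
      | succ n ih =>
        rw [← h.top_mul_pow hgen, pow_succ]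
        exact mul_le_mul_left ih _
    have hJ : Ideal.span (Set.range x) ≤ Ring.jacobson A := by
      refine le_ringJacobson_of_forall_isNilpotent _ fun y hy => ⟨N, ?_⟩
      have := hpow N (Submodule.pow_mem_pow _ (hspan y hy) N)
      rwa [hN, Submodule.mul_bot, Submodule.mem_bot] at this
    refine Submodule.mul_le.2 fun a _ t ht => mem_radFiltration_one.2 (Ideal.mul_mem_left _ a ?_)
    induction ht using Submodule.span_induction with
    | mem y hy => exact hJ (Ideal.subset_span hy)
    | zero => exact zero_mem _
    | add y z _ _ hy hz => exact add_mem hy hz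
    | smul c y _ hy =>
      rw [Algebra.smul_def]
      exact Ideal.mul_mem_left _ _ hy
  have hone : radFiltration k A 1 = ⊤ * T := by
    refine le_antisymm (fun y hy => ?_) hle
    obtain ⟨u, hu, t, ht, rfl⟩ :=
      Submodule.mem_sup.1 (h.span_vertex_sup_eq_top hgen ▸ Submodule.mem_top : y ∈ _)
    have huJ : u ∈ Ring.jacobson A :=
      mem_radFiltration_one.1 ((Submodule.add_mem_iff_left _ (hle ht)).1 hy)
    obtain ⟨c, rfl⟩ := (Submodule.mem_span_range_iff_exists_fun k).1 hu
    -- The radical is nilpotent, so that it contains no nonzero multiple of an idempotent.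
    have hc : ∀ w, c w • e w = 0 := by
      intro w
      by_cases hcw : c w = 0
      · rw [hcw, zero_smul]
      have hw : e w * ∑ v, c v • e v = c w • e w := by
        rw [Finset.mul_sum, Finset.sum_eq_single w]
        · rw [mul_smul_comm, h.idem]
        · intro v _ hv
          rw [mul_smul_comm, h.orth w v hv.symm, smul_zero]
        · exact fun hw => absurd (Finset.mem_univ w) hw
      have hwJ : e w ∈ Ring.jacobson A := by
        have h1 := Ideal.mul_mem_left _ (algebraMap k A (c w)⁻¹) (Ideal.mul_mem_left _ (e w) huJ)
        rwa [hw, ← Algebra.smul_def, smul_smul, inv_mul_cancel₀ hcw, one_smul] at h1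
      obtain ⟨M, hM⟩ := IsSemiprimaryRing.isNilpotent (R := A)
      have h0 : e w ^ (M + 1) ∈ Ring.jacobson A ^ M :=
        Ideal.pow_le_pow_right M.le_succ (Ideal.pow_mem_pow hwJ _)
      rw [hM, (show IsIdempotentElem (e w) from h.idem w).pow_succ_eq] at h0
      rw [(Submodule.mem_bot A).1 h0, smul_zero]
    rw [Finset.sum_eq_zero fun w _ => hc w, zero_add]
    exact ht
  induction n with
  | zero => rw [radFiltration_zero, pow_zero, mul_one]
  | succ n ih => rw [radFiltration_succ, ih, hone, h.top_mul_pow hgen]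

end IsPathFamily

/-! ### Homogeneous relations -/

section Coaction

open Polynomial

variable {k : Type u} [Field k] {A : Type u} [Ring A] [Algebra k A]

/-- The elements `a` of degree `n` with respect to a homomorphism `δ : A → A[X]`, that is, those
with `δ a = a Xⁿ`. -/
noncomputable def degreePiece (δ : A →ₐ[k] A[X]) (n : ℕ) : Submodule k A :=
  LinearMap.eqLocus δ.toLinearMap ((monomial n : A →ₗ[A] A[X]).restrictScalars k)

theorem mem_degreePiece {δ : A →ₐ[k] A[X]} {n : ℕ} {a : A} :
    a ∈ degreePiece δ n ↔ δ a = monomial n a :=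
  Iff.rfl

instance (δ : A →ₐ[k] A[X]) : SetLike.GradedMonoid (degreePiece δ) where
  one_mem := mem_degreePiece.2 (map_one δ)
  mul_mem m n a b ha hb := by
    rw [mem_degreePiece] at ha hb ⊢
    rw [map_mul, ha, hb, monomial_mul_monomial]

/-- A homomorphism `δ : A → A[X]` such that `A` is generated by elements of some degree with respect
to `δ` defines a grading. The components of `a` are the coefficients of `δ a`. -/
theorem isInternal_degreePiece (δ : A →ₐ[k] A[X]) {s : Set A} (hs : Algebra.adjoin k s = ⊤)
    (hδ : ∀ a ∈ s, ∃ n, a ∈ degreePiece δ n) : DirectSum.IsInternal (degreePiece δ) := by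
  constructor
  · have hcoeff : ∀ (z : DirectSum ℕ fun n => degreePiece δ n) (i : ℕ),
        (δ (DirectSum.coeAlgHom (degreePiece δ) z)).coeff i = z i := by
      intro z i
      induction z using DirectSum.induction_on with
      | zero => rw [map_zero, map_zero]; rfl
      | of j a =>
        rw [DirectSum.coeAlgHom_of, mem_degreePiece.1 a.2, coeff_monomial, DirectSum.coe_of_apply]
        split_ifs <;> rfl
      | add z w hz hw =>
        rw [map_add, map_add, coeff_add, hz, hw]
        rfl
    intro z w hzw
    refine DFinsupp.ext fun i => Subtype.ext ?_
    rw [← hcoeff, ← hcoeff]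
    exact congrArg (fun a => (δ a).coeff i) hzw
  · have htop : (DirectSum.coeAlgHom (degreePiece δ)).range = ⊤ := by
      rw [eq_top_iff, ← hs, Algebra.adjoin_le_iff]
      intro a ha
      obtain ⟨n, hn⟩ := hδ a ha
      exact ⟨DirectSum.of (fun n => degreePiece δ n) n ⟨a, hn⟩, DirectSum.coeAlgHom_of _ _ _⟩
    exact AlgHom.range_eq_top _ |>.1 htop

end Coaction

namespace IsPathFamily

open Polynomial

variable {k : Type u} [Field k] {A : Type u} [Ring A] [Algebra k A]
  {V : Type} [Fintype V] [Quiver.{0} V] {e : V → A} {x : Quiver.Total V → A}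

theorem polynomial (h : IsPathFamily e x) :
    IsPathFamily (fun v => (C (e v) : A[X])) (fun f => C (x f) * X) where
  idem v := by rw [← C_mul, h.idem]
  orth v w hvw := by rw [← C_mul, h.orth v w hvw, C_0]
  sum_one := by rw [← map_sum, h.sum_one, C_1]
  source f := by rw [← mul_assoc, ← C_mul, h.source]
  target f := by rw [mul_assoc, X_mul, ← mul_assoc, ← C_mul, h.target]

/-- The linear combinations of the vertices form a semisimple algebra. -/
theorem isSemisimpleRing_of_eq_span {S : Type*} [Ring S] (h : IsPathFamily e x) (i : S →+* A)
    (hi : Function.Injective i)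
    (hS : Set.range i = (Submodule.span k (Set.range e) : Set A)) : IsSemisimpleRing S := by
  let g : (V → k) →+* A :=
    { toFun := fun c => ∑ v, c v • e v
      map_one' := by simpa using h.sum_one
      map_zero' := by simp
      map_add' := fun c d => by simp [add_smul, Finset.sum_add_distrib]
      map_mul' := fun c d => by
        rw [Finset.sum_mul_sum]
        refine Finset.sum_congr rfl fun v _ => ?_
        rw [Finset.sum_eq_single v]
        · rw [smul_mul_smul_comm, h.idem]
          rfl
        · intro w _ hw
          rw [smul_mul_smul_comm, h.orth v w hw.symm, smul_zero]
        · exact fun hv => absurd (Finset.mem_univ v) hv }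
  have hg : Set.range g = Set.range i := by
    rw [hS]
    ext a
    exact (Submodule.mem_span_range_iff_exists_fun k).symm
  choose s hs using fun c => (hg ▸ Set.mem_range_self c : g c ∈ Set.range i)
  let g' : (V → k) →+* S :=
    { toFun := s
      map_one' := hi (by rw [hs, map_one, map_one])
      map_zero' := hi (by rw [hs, map_zero, map_zero])
      map_add' := fun c d => hi (by rw [hs, map_add, map_add, hs, hs])
      map_mul' := fun c d => hi (by rw [hs, map_mul, map_mul, hs, hs]) }
  refine RingHom.isSemisimpleRing_of_surjective g' fun a => ?_
  obtain ⟨c, hc⟩ := (hg ▸ Set.mem_range_self a : i a ∈ Set.range g)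
  exact ⟨c, hi ((hs c).trans hc)⟩

end IsPathFamily

section Homogeneous

open Polynomial

variable {k : Type u} [Field k]

/-- If the relations are homogeneous, where vertices have degree `0` and arrows have degree `1`,
then `kQ / I` has a tight grading. Homogeneity is expressed by means of the homomorphism
`kQ → (kQ / I)[X]` that multiplies every arrow by `X`. -/
theorem QuiverWithRelations.hasTightGrading (Q : QuiverWithRelations k)
    (hQ : ∀ a b, Q.rel a b → PathAlgebra.lift (k := k) Q.isPathFamily.polynomial a =
      PathAlgebra.lift (k := k) Q.isPathFamily.polynomial b) :
    HasTightGrading k Q.QuotAlgebra := by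
  have h := Q.isPathFamily
  let δ : Q.QuotAlgebra →ₐ[k] Q.QuotAlgebra[X] := lift (PathAlgebra.lift h.polynomial) hQ
  have hδe : ∀ v, δ (Q.vertex v) = C (Q.vertex v) := fun v => by
    rw [vertex, lift_proj, PathAlgebra.lift_vertex]
    rfl
  have hδx : ∀ f, δ (Q.arrow f) = C (Q.arrow f) * X := fun f => by
    rw [arrow, lift_proj, PathAlgebra.lift_arrow]
    rfl
  have hmem0 : ∀ v, Q.vertex v ∈ degreePiece δ 0 := hδe
  have hmem1 : ∀ f, Q.arrow f ∈ degreePiece δ 1 := fun f => by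
    rw [mem_degreePiece, hδx, C_mul_X_eq_monomial]
  have hint : DirectSum.IsInternal (degreePiece δ) := by
    refine isInternal_degreePiece δ Q.adjoin_eq_top ?_
    rintro _ (⟨v, rfl⟩ | ⟨f, rfl⟩)
    exacts [⟨0, hmem0 v⟩, ⟨1, hmem1 f⟩]
  have hcoeff : ∀ a, (δ a).coeff 0 ∈ Submodule.span k (Set.range Q.vertex) := by
    intro a
    have ha : a ∈ Algebra.adjoin k (Set.range Q.vertex ∪ Set.range Q.arrow) :=
      Q.adjoin_eq_top ▸ Algebra.mem_top
    induction ha using Algebra.adjoin_induction with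
    | mem a ha =>
      rcases ha with ⟨v, rfl⟩ | ⟨f, rfl⟩
      · rw [hδe, coeff_C_zero]
        exact Submodule.subset_span ⟨v, rfl⟩
      · rw [hδx, coeff_mul_X_zero]
        exact zero_mem _
    | algebraMap c =>
      rw [AlgHom.commutes, Algebra.algebraMap_eq_smul_one, coeff_smul, coeff_one_zero]
      exact Submodule.smul_mem _ c h.one_mem_span_vertex
    | add a b _ _ ha hb => rw [map_add, coeff_add]; exact add_mem ha hb
    | mul a b _ _ ha hb =>
      rw [map_mul, mul_coeff_zero]
      exact h.span_vertex_mul_le (Submodule.mul_mem_mul ha hb)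
  have hzero : degreePiece δ 0 = Submodule.span k (Set.range Q.vertex) := by
    refine le_antisymm (fun a ha => ?_) (Submodule.span_le.2 ?_)
    · have := hcoeff a
      rwa [mem_degreePiece.1 ha, coeff_monomial_same] at this
    · rintro _ ⟨v, rfl⟩
      exact hmem0 v
  let gr : GradedAlgebra (degreePiece δ) := hint.gradedAlgebra
  refine ⟨degreePiece δ, gr, ?_, ?_⟩
  · refine h.isSemisimpleRing_of_eq_span (k := k)
      (SetLike.GradeZero.subring (degreePiece δ)).subtype
      Subtype.val_injective ?_
    rw [← hzero]
    exact Subtype.range_val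
  · rw [eq_top_iff, ← Q.adjoin_eq_top]
    refine Algebra.adjoin_mono (Set.union_subset_union ?_ ?_)
    · rintro _ ⟨v, rfl⟩
      exact hmem0 v
    · rintro _ ⟨f, rfl⟩
      exact hmem1 f

end Homogeneous

/-! ### Products of arrows from the left -/

section ArrowProducts

open Submodule

variable {k : Type u} [Field k] {A : Type u} [Ring A] [Algebra k A] {ι : Type*} {x : ι → A}

theorem mem_span_singleton_of_eq_zero {a b : A} (h : a = 0) : a ∈ span k {b} :=
  h ▸ zero_mem _

/-- If all products `x i * b` are multiples of `g * b`, then the products of the `x i` with `b * z`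
are multiples of `g * (b * z)`. -/
theorem span_range_mul_span_singleton_le {b g : A} (h : ∀ i, x i * b ∈ span k {g * b}) (z : A) :
    span k (Set.range x) * span k {b * z} ≤ span k {g * (b * z)} := by
  rw [span_mul_span, span_le]
  rintro _ ⟨_, ⟨i, rfl⟩, _, rfl, rfl⟩
  obtain ⟨c, hc⟩ := mem_span_singleton.1 (h i)
  refine mem_span_singleton.2 ⟨c, ?_⟩
  change c • (g * (b * z)) = x i * (b * z)
  rw [← mul_assoc, ← mul_assoc, ← hc, smul_mul_assoc]

theorem pow_four_mul_span_singleton_le {T : Submodule k A} {y₀ y₁ y₂ y₃ y₄ : A}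
    (h₁ : T * span k {y₀} ≤ span k {y₁}) (h₂ : T * span k {y₁} ≤ span k {y₂})
    (h₃ : T * span k {y₂} ≤ span k {y₃}) (h₄ : T * span k {y₃} ≤ span k {y₄}) :
    T ^ 4 * span k {y₀} ≤ span k {y₄} := by
  rw [show T ^ 4 = T * (T * (T * T)) by simp only [pow_succ, pow_zero, one_mul, mul_assoc]]
  simp only [mul_assoc]
  exact (mul_le_mul_right ((mul_le_mul_right ((mul_le_mul_right h₁ T).trans h₂) T).trans h₃)
    T).trans h₄

theorem pow_succ_span_range_eq_bot {N : ℕ}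
    (h : ∀ i, span k (Set.range x) ^ N * span k {x i} = ⊥) :
    span k (Set.range x) ^ (N + 1) = ⊥ := by
  rw [pow_succ, eq_bot_iff, mul_le]
  intro a ha t ht
  induction ht using span_induction with
  | mem t ht =>
    obtain ⟨i, rfl⟩ := ht
    exact h i ▸ mul_mem_mul ha (mem_span_singleton_self _)
  | zero => simp
  | add t s _ _ ht hs => rw [mul_add]; exact add_mem ht hs
  | smul c t _ ht => rw [mul_smul_comm]; exact smul_mem _ c ht

end ArrowProducts

/-! ### The algebra `C_r` -/

section AlgebraC

variable (k : Type u) [Field k] (r : ℕ)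

/-- The quiver with relations that defines `C_r` for `r ≠ 1`. -/
def quiverGenericC : QuiverWithRelations k where
  V := CVertex
  rel := CRel k r

theorem quiverC_of_ne_one (hr : r ≠ 1) : quiverC k r = quiverGenericC k r :=
  if_neg hr

/-- Case distinction for the arrows of the quiver of `C_r`. -/
theorem CArrow.forall_total {P : Quiver.Total CVertex → Prop} (h₁ : P ⟨_, _, CArrow.a1⟩)
    (h₂ : P ⟨_, _, CArrow.a2⟩) (h₃ : P ⟨_, _, CArrow.b1⟩) (h₄ : P ⟨_, _, CArrow.b2⟩)
    (h₅ : P ⟨_, _, CArrow.c⟩) : ∀ f, P f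
  | ⟨_, _, f⟩ => match f with
    | .a1 => h₁
    | .a2 => h₂
    | .b1 => h₃
    | .b2 => h₄
    | .c => h₅

instance : Finite (Quiver.Total CVertex) :=
  Finite.of_surjective (fun i : Fin 5 =>
    (![⟨_, _, CArrow.a1⟩, ⟨_, _, CArrow.a2⟩, ⟨_, _, CArrow.b1⟩, ⟨_, _, CArrow.b2⟩,
      ⟨_, _, CArrow.c⟩] i : Quiver.Total CVertex))
    (CArrow.forall_total ⟨0, rfl⟩ ⟨1, rfl⟩ ⟨2, rfl⟩ ⟨3, rfl⟩ ⟨4, rfl⟩)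

/-- The projection from the path algebra to `C_r`. -/
noncomputable def projC : PathAlgebra k CVertex →ₐ[k] (quiverGenericC k r).QuotAlgebra :=
  (quiverGenericC k r).proj

/-- An arrow of the quiver of `C_r` as an element of `C_r`. -/
noncomputable def CArrow.toAlg {v w : CVertex} (f : CArrow v w) :
    (quiverGenericC k r).QuotAlgebra :=
  projC k r (f.path k)

variable {k r}

theorem projC_eq_of_rel {a b : PathAlgebra k CVertex} (h : CRel k r a b) :
    projC k r a = projC k r b :=
  QuiverWithRelations.proj_eq_of_rel (Q := quiverGenericC k r) h

theorem CArrow.mul_eq_zero {v w v' w' : CVertex} (f : CArrow v w) (g : CArrow v' w')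
    (h : w ≠ v') : f.toAlg k r * g.toAlg k r = 0 :=
  (quiverGenericC k r).isPathFamily.mul_eq_zero (f := ⟨v, w, f⟩) (g := ⟨v', w', g⟩) h

open CArrow Submodule

theorem CArrow.a1_mul_b1 : a1.toAlg k r * b1.toAlg k r = 0 := by
  simpa only [CArrow.toAlg, map_mul, map_zero] using projC_eq_of_rel (k := k) (r := r) CRel.a1b1

theorem CArrow.b2_mul_a2 : b2.toAlg k r * a2.toAlg k r = 0 := by
  simpa only [CArrow.toAlg, map_mul, map_zero] using projC_eq_of_rel (k := k) (r := r) CRel.b2a2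

theorem CArrow.a2_mul_c : a2.toAlg k r * c.toAlg k r = 0 := by
  simpa only [CArrow.toAlg, map_mul, map_zero] using projC_eq_of_rel (k := k) (r := r) CRel.a2c

theorem CArrow.c_mul_b2 : c.toAlg k r * b2.toAlg k r = 0 := by
  simpa only [CArrow.toAlg, map_mul, map_zero] using projC_eq_of_rel (k := k) (r := r) CRel.cb2

theorem CArrow.c_pow :
    c.toAlg k r ^ r = b2.toAlg k r * b1.toAlg k r * a1.toAlg k r * a2.toAlg k r := by
  simpa only [CArrow.toAlg, map_mul, map_pow] using projC_eq_of_rel (k := k) (r := r) CRel.pow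

theorem CArrow.a1_mul_b1_mul (z) : a1.toAlg k r * (b1.toAlg k r * z) = 0 := by
  rw [← mul_assoc, a1_mul_b1, zero_mul]

theorem CArrow.b2_mul_a2_mul (z) : b2.toAlg k r * (a2.toAlg k r * z) = 0 := by
  rw [← mul_assoc, b2_mul_a2, zero_mul]

theorem CArrow.a2_mul_b2_mul_b1_mul_a1_mul (z) :
    a2.toAlg k r * (b2.toAlg k r * (b1.toAlg k r * (a1.toAlg k r * z))) =
      b1.toAlg k r * (a1.toAlg k r * (a2.toAlg k r * (b2.toAlg k r * z))) := by
  have h : a2.toAlg k r * b2.toAlg k r * b1.toAlg k r * a1.toAlg k r =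
      b1.toAlg k r * a1.toAlg k r * a2.toAlg k r * b2.toAlg k r := by
    simpa only [CArrow.toAlg, map_mul] using projC_eq_of_rel (k := k) (r := r) CRel.comm
  simp only [← mul_assoc, h]

theorem CArrow.c_pow_succ_self : c.toAlg k r ^ (r + 1) = 0 := by
  rw [pow_succ', c_pow]
  simp only [← mul_assoc, c_mul_b2, zero_mul]

variable (k r) in
/-- The span of the arrows in `C_r`. -/
noncomputable abbrev arrowSpanC : Submodule k (quiverGenericC k r).QuotAlgebra :=
  span k (Set.range (quiverGenericC k r).arrow)

theorem arrowSpanC_mul_a1 (z) :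
    arrowSpanC k r * span k {a1.toAlg k r * z} ≤ span k {b1.toAlg k r * (a1.toAlg k r * z)} :=
  span_range_mul_span_singleton_le (CArrow.forall_total
    (mem_span_singleton_of_eq_zero (CArrow.mul_eq_zero a1 a1 (by simp)))
    (mem_span_singleton_of_eq_zero (CArrow.mul_eq_zero a2 a1 (by simp)))
    (mem_span_singleton_self _)
    (mem_span_singleton_of_eq_zero (CArrow.mul_eq_zero b2 a1 (by simp)))
    (mem_span_singleton_of_eq_zero (CArrow.mul_eq_zero c a1 (by simp)))) z

theorem arrowSpanC_mul_a2 (z) :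
    arrowSpanC k r * span k {a2.toAlg k r * z} ≤ span k {a1.toAlg k r * (a2.toAlg k r * z)} :=
  span_range_mul_span_singleton_le (CArrow.forall_total
    (mem_span_singleton_self _)
    (mem_span_singleton_of_eq_zero (CArrow.mul_eq_zero a2 a2 (by simp)))
    (mem_span_singleton_of_eq_zero (CArrow.mul_eq_zero b1 a2 (by simp)))
    (mem_span_singleton_of_eq_zero b2_mul_a2)
    (mem_span_singleton_of_eq_zero (CArrow.mul_eq_zero c a2 (by simp)))) z

theorem arrowSpanC_mul_b1 (z) :
    arrowSpanC k r * span k {b1.toAlg k r * z} ≤ span k {b2.toAlg k r * (b1.toAlg k r * z)} :=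
  span_range_mul_span_singleton_le (CArrow.forall_total
    (mem_span_singleton_of_eq_zero a1_mul_b1)
    (mem_span_singleton_of_eq_zero (CArrow.mul_eq_zero a2 b1 (by simp)))
    (mem_span_singleton_of_eq_zero (CArrow.mul_eq_zero b1 b1 (by simp)))
    (mem_span_singleton_self _)
    (mem_span_singleton_of_eq_zero (CArrow.mul_eq_zero c b1 (by simp)))) z

theorem arrowSpanC_mul_b2 (z) :
    arrowSpanC k r * span k {b2.toAlg k r * z} ≤ span k {a2.toAlg k r * (b2.toAlg k r * z)} :=
  span_range_mul_span_singleton_le (CArrow.forall_total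
    (mem_span_singleton_of_eq_zero (CArrow.mul_eq_zero a1 b2 (by simp)))
    (mem_span_singleton_self _)
    (mem_span_singleton_of_eq_zero (CArrow.mul_eq_zero b1 b2 (by simp)))
    (mem_span_singleton_of_eq_zero (CArrow.mul_eq_zero b2 b2 (by simp)))
    (mem_span_singleton_of_eq_zero c_mul_b2)) z

theorem arrowSpanC_mul_c (z) :
    arrowSpanC k r * span k {c.toAlg k r * z} ≤ span k {c.toAlg k r * (c.toAlg k r * z)} :=
  span_range_mul_span_singleton_le (CArrow.forall_total
    (mem_span_singleton_of_eq_zero (CArrow.mul_eq_zero a1 c (by simp)))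
    (mem_span_singleton_of_eq_zero a2_mul_c)
    (mem_span_singleton_of_eq_zero (CArrow.mul_eq_zero b1 c (by simp)))
    (mem_span_singleton_of_eq_zero (CArrow.mul_eq_zero b2 c (by simp)))
    (mem_span_singleton_self _)) z

/-- Reading from the right, each step extends `a₁` to the left by the only arrow that can give a
nonzero product, until the path `a₁a₂b₂b₁a₁` vanishes. -/
theorem arrowSpanC_pow_four_mul_a1 : arrowSpanC k r ^ 4 * span k {a1.toAlg k r} = ⊥ := by
  have h := pow_four_mul_span_singleton_le (arrowSpanC_mul_a1 (k := k) (r := r) 1)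
    (arrowSpanC_mul_b1 _) (arrowSpanC_mul_b2 _) (arrowSpanC_mul_a2 _)
  simp only [a2_mul_b2_mul_b1_mul_a1_mul, a1_mul_b1_mul] at h
  rwa [mul_one, span_zero_singleton, le_bot_iff] at h

theorem arrowSpanC_pow_four_mul_a2 : arrowSpanC k r ^ 4 * span k {a2.toAlg k r} = ⊥ := by
  have h := pow_four_mul_span_singleton_le (arrowSpanC_mul_a2 (k := k) (r := r) 1)
    (arrowSpanC_mul_a1 _) (arrowSpanC_mul_b1 _) (arrowSpanC_mul_b2 _)
  simp only [a2_mul_b2_mul_b1_mul_a1_mul, b2_mul_a2_mul, mul_zero] at h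
  rwa [mul_one, span_zero_singleton, le_bot_iff] at h

theorem arrowSpanC_pow_four_mul_b1 : arrowSpanC k r ^ 4 * span k {b1.toAlg k r} = ⊥ := by
  have h := pow_four_mul_span_singleton_le (arrowSpanC_mul_b1 (k := k) (r := r) 1)
    (arrowSpanC_mul_b2 _) (arrowSpanC_mul_a2 _) (arrowSpanC_mul_a1 _)
  simp only [← a2_mul_b2_mul_b1_mul_a1_mul, a1_mul_b1_mul, mul_zero] at h
  rwa [mul_one, span_zero_singleton, le_bot_iff] at h

theorem arrowSpanC_pow_four_mul_b2 : arrowSpanC k r ^ 4 * span k {b2.toAlg k r} = ⊥ := by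
  have h := pow_four_mul_span_singleton_le (arrowSpanC_mul_b2 (k := k) (r := r) 1)
    (arrowSpanC_mul_a2 _) (arrowSpanC_mul_a1 _) (arrowSpanC_mul_b1 _)
  simp only [← a2_mul_b2_mul_b1_mul_a1_mul, b2_mul_a2_mul] at h
  rwa [mul_one, span_zero_singleton, le_bot_iff] at h

theorem arrowSpanC_pow_mul_c : arrowSpanC k r ^ r * span k {c.toAlg k r} = ⊥ := by
  have h : ∀ n, arrowSpanC k r ^ n * span k {c.toAlg k r} ≤ span k {c.toAlg k r ^ (n + 1)} := by
    intro n
    induction n with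
    | zero => simp
    | succ n ih =>
      rw [pow_succ', mul_assoc, pow_succ' _ (n + 1), pow_succ' _ n]
      rw [pow_succ' _ n] at ih
      exact (mul_le_mul_right ih _).trans (arrowSpanC_mul_c _)
  have h' := h r
  rwa [c_pow_succ_self, span_zero_singleton, le_bot_iff] at h'

variable (k r) in
theorem arrowSpanC_pow_eq_bot : arrowSpanC k r ^ (r + 4 + 1) = ⊥ := by
  have h4 : ∀ x, arrowSpanC k r ^ 4 * span k {x} = ⊥ → arrowSpanC k r ^ (r + 4) * span k {x} = ⊥ :=
    fun x hx => by rw [pow_add, mul_assoc, hx, mul_bot]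
  refine pow_succ_span_range_eq_bot ?_
  refine CArrow.forall_total (h4 _ arrowSpanC_pow_four_mul_a1) (h4 _ arrowSpanC_pow_four_mul_a2)
    (h4 _ arrowSpanC_pow_four_mul_b1) (h4 _ arrowSpanC_pow_four_mul_b2) ?_
  rw [add_comm, pow_add, mul_assoc]
  exact (congrArg _ arrowSpanC_pow_mul_c).trans (mul_bot _)

end AlgebraC

/-! ### A representation of `C_r` -/

section Representation

open CArrow

variable (k : Type u) [Field k] (r : ℕ)

/-- The space of a representation of the quiver of `C_r`, with the spaces `k`, `k × k` and `ℕ → k`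
at the vertices `1`, `2` and `3`. It contains a copy of the projective module `C_r e₃` for `r ≥ 2`:
in `k` the path `a₁a₂`, in `k × k` the paths `a₂` and `b₁a₁a₂`, and in `ℕ → k` the paths
`c^(r - n)`, for `n ≤ r`, as the basis vectors of index `n`. -/
abbrev RepC : Type u := k × (k × k) × (ℕ → k)

/-- The action of the trivial paths. -/
def repVertex : CVertex → Module.End k (RepC k)
  | .v1 =>
    { toFun := fun m => (m.1, 0, 0)
      map_add' := fun m m' => by simp
      map_smul' := fun c m => by simp }
  | .v2 =>
    { toFun := fun m => (0, m.2.1, 0)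
      map_add' := fun m m' => by simp
      map_smul' := fun c m => by simp }
  | .v3 =>
    { toFun := fun m => (0, 0, m.2.2)
      map_add' := fun m m' => by simp
      map_smul' := fun c m => by simp }

/-- The action of the arrows. As paths are composed from left to right, an arrow `v ⟶ w` maps the
space at `w` to the space at `v`. -/
def repArrow : ∀ {v w : CVertex}, CArrow v w → Module.End k (RepC k)
  | _, _, .a1 =>
    { toFun := fun m => (m.2.1.1, 0, 0)
      map_add' := fun m m' => by simp
      map_smul' := fun c m => by simp }
  | _, _, .a2 =>
    { toFun := fun m => (0, (m.2.2 r, 0), 0)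
      map_add' := fun m m' => by simp
      map_smul' := fun c m => by simp }
  | _, _, .b1 =>
    { toFun := fun m => (0, (0, m.1), 0)
      map_add' := fun m m' => by simp
      map_smul' := fun c m => by simp }
  | _, _, .b2 =>
    { toFun := fun m => (0, 0, Pi.single 0 m.2.1.2)
      map_add' := fun m m' => by simp [Pi.single_add]
      map_smul' := fun c m => by simp [← Pi.single_smul] }
  | _, _, .c =>
    { toFun := fun m => (0, 0, fun n => if n < r then m.2.2 (n + 1) else 0)
      map_add' := fun m m' => by
        refine Prod.ext (by simp) (Prod.ext (by simp) (funext fun n => ?_))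
        by_cases h : n < r <;> simp [h]
      map_smul' := fun c m => by
        refine Prod.ext (by simp) (Prod.ext (by simp) (funext fun n => ?_))
        by_cases h : n < r <;> simp [h] }

theorem isPathFamily_rep :
    IsPathFamily (repVertex k) (fun f : Quiver.Total CVertex => repArrow k r f.hom) where
  idem v := by cases v <;> rfl
  orth v w h := by
    cases v <;> cases w <;> first | exact absurd rfl h | rfl
  sum_one := by
    have h : (Finset.univ : Finset CVertex) = {.v1, .v2, .v3} := rfl
    rw [h]
    refine LinearMap.ext fun m => ?_
    simp [repVertex, Prod.mk_zero_zero]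
  source := CArrow.forall_total rfl rfl rfl rfl rfl
  target := CArrow.forall_total rfl rfl rfl rfl rfl

/-- The exponent is `n + 1` because `c` to the power `0` also acts as the identity on the spaces at
the vertices `1` and `2`. -/
theorem repArrow_c_pow (n : ℕ) (m : RepC k) :
    (repArrow k r c ^ (n + 1)) m =
      (0, 0, fun i => if i + n < r then m.2.2 (i + n + 1) else 0) := by
  induction n generalizing m with
  | zero => rfl
  | succ n ih =>
    rw [pow_succ, Module.End.mul_apply, ih]
    refine Prod.ext rfl (Prod.ext rfl (funext fun i => ?_))
    change (if i + n < r then (if i + n + 1 < r then m.2.2 (i + n + 1 + 1) else 0) else 0) =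
      if i + n + 1 < r then m.2.2 (i + n + 1 + 1) else 0
    split_ifs <;> first | rfl | omega

variable {r}

/-- A homomorphism from the path algebra respects the relations of `C_r` as soon as the images of
the arrows satisfy them. -/
theorem CRel.map_eq {k : Type u} [Field k] {r : ℕ} {B : Type*} [Ring B] [Algebra k B]
    (F : PathAlgebra k CVertex →ₐ[k] B)
    {x : ∀ {v w : CVertex}, CArrow v w → B} (hF : ∀ {v w} (f : CArrow v w), F (f.path k) = x f)
    (h₁ : x a1 * x b1 = 0) (h₂ : x b2 * x a2 = 0) (h₃ : x a2 * x c = 0) (h₄ : x c * x b2 = 0)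
    (h₅ : x c ^ r = x b2 * x b1 * x a1 * x a2)
    (h₆ : x a2 * x b2 * x b1 * x a1 = x b1 * x a1 * x a2 * x b2) :
    ∀ a b, CRel k r a b → F a = F b := by
  intro a b hab
  cases hab <;> simpa only [map_mul, map_pow, map_zero, hF]

/-- The representation as a homomorphism to an endomorphism algebra. -/
noncomputable def repC (hr : r ≠ 0) :
    (quiverGenericC k r).QuotAlgebra →ₐ[k] Module.End k (RepC k) :=
  QuiverWithRelations.lift (PathAlgebra.lift (isPathFamily_rep k r)) <| by
    refine CRel.map_eq (k := k) (r := r) (PathAlgebra.lift (isPathFamily_rep k r))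
      (x := repArrow k r)
      (fun {v w} f => PathAlgebra.lift_arrow (isPathFamily_rep k r) (show v ⟶ w from f))
      rfl (LinearMap.ext fun m => ?_) (LinearMap.ext fun m => ?_) (LinearMap.ext fun m => ?_)
      (LinearMap.ext fun m => ?_) (LinearMap.ext fun m => ?_)
    · simp [repArrow]
    · simp [repArrow]
    · refine Prod.ext rfl (Prod.ext rfl (funext fun n => ?_))
      simp [repArrow]
    · obtain ⟨s, rfl⟩ := Nat.exists_eq_succ_of_ne_zero hr
      rw [repArrow_c_pow]
      refine Prod.ext rfl (Prod.ext rfl (funext fun n => ?_))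
      rcases n with _ | n <;> simp [repArrow]
    · simp [repArrow, hr]

theorem repC_toAlg (hr : r ≠ 0) {v w} (f : CArrow v w) :
    repC k hr (f.toAlg k r) = repArrow k r f :=
  (QuiverWithRelations.lift_proj _ _ _).trans
    (PathAlgebra.lift_arrow (isPathFamily_rep k r) (show v ⟶ w from f))

theorem CArrow.c_pow_ne_zero (hr : r ≠ 0) : c.toAlg k r ^ r ≠ 0 := by
  intro h
  have h' := congrArg (repC k hr) h
  rw [map_pow, map_zero, repC_toAlg] at h'
  obtain ⟨s, rfl⟩ := Nat.exists_eq_succ_of_ne_zero hr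
  have h1 := congrFun (congrArg (fun m => m.2.2)
    (LinearMap.congr_fun h' (0, 0, fun _ => (1 : k)))) 0
  rw [repArrow_c_pow] at h1
  simp at h1

end Representation

/-! ### Tight gradings of `C_r` -/

section TightC

open CArrow Submodule

variable {k : Type u} [Field k] {r : ℕ}

instance : Finite (Quiver.Total (quiverGenericC k r).V) :=
  inferInstanceAs (Finite (Quiver.Total CVertex))

instance : Module.Finite k (quiverGenericC k r).QuotAlgebra :=
  (quiverGenericC k r).isPathFamily.finite_of_pow_eq_bot (quiverGenericC k r).adjoin_eq_top
    (arrowSpanC_pow_eq_bot k r)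

theorem radFiltration_quiverGenericC (n : ℕ) :
    radFiltration k (quiverGenericC k r).QuotAlgebra n = ⊤ * arrowSpanC k r ^ n :=
  (quiverGenericC k r).isPathFamily.radFiltration_eq (quiverGenericC k r).adjoin_eq_top
    (arrowSpanC_pow_eq_bot k r) n

theorem CArrow.toAlg_mem_radFiltration {v w} (f : CArrow v w) :
    f.toAlg k r ∈ radFiltration k (quiverGenericC k r).QuotAlgebra 1 := by
  rw [radFiltration_quiverGenericC, pow_one]
  exact le_top_mul _ (subset_span ⟨⟨v, w, f⟩, rfl⟩)

theorem CArrow.b2_mul_b1_mul_a1_mem_radFiltration : b2.toAlg k r * b1.toAlg k r * a1.toAlg k r ∈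
    radFiltration k (quiverGenericC k r).QuotAlgebra 3 :=
  radFiltration_mul_mem (m := 2) (radFiltration_mul_mem (m := 1) (toAlg_mem_radFiltration _)
    (toAlg_mem_radFiltration _)) (toAlg_mem_radFiltration _)

theorem CArrow.c_pow_mem_radFiltration (n : ℕ) :
    c.toAlg k r ^ n ∈ radFiltration k (quiverGenericC k r).QuotAlgebra n := by
  induction n with
  | zero => rw [radFiltration_zero]; exact mem_top
  | succ n ih =>
    rw [pow_succ]
    exact radFiltration_mul_mem ih (toAlg_mem_radFiltration c)

theorem mul_eq_zero_of_mem_radFiltration {n : ℕ} {x z : (quiverGenericC k r).QuotAlgebra}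
    (hx : arrowSpanC k r ^ n * span k {x} = ⊥)
    (hz : z ∈ radFiltration k (quiverGenericC k r).QuotAlgebra n) : z * x = 0 := by
  have h := mul_mem_mul hz (mem_span_singleton_self (R := k) x)
  rwa [radFiltration_quiverGenericC, mul_assoc, hx, mul_bot, mem_bot] at h

/-- To bound the products of `x` with radical elements, it suffices to bound those with arrows. -/
theorem mul_mem_radFiltration_of_forall {n : ℕ} {x : (quiverGenericC k r).QuotAlgebra}
    (h : ∀ f : Quiver.Total CVertex,
      x * CArrow.toAlg k r (show CArrow f.left f.right from f.hom) ∈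
        radFiltration k (quiverGenericC k r).QuotAlgebra n) :
    ∀ j ∈ radFiltration k (quiverGenericC k r).QuotAlgebra 1,
      x * j ∈ radFiltration k (quiverGenericC k r).QuotAlgebra n := by
  intro j hj
  rw [radFiltration_quiverGenericC, pow_one,
    (quiverGenericC k r).isPathFamily.top_mul_eq_mul_top (quiverGenericC k r).adjoin_eq_top] at hj
  induction hj using Submodule.mul_induction_on' with
  | mem_mul_mem t ht a _ =>
    rw [← mul_assoc]
    refine radFiltration_mul_mem (n := 0) ?_ (by rw [radFiltration_zero]; exact mem_top)
    induction ht using span_induction with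
    | mem t ht =>
      obtain ⟨f, rfl⟩ := ht
      exact h f
    | zero => rw [mul_zero]; exact zero_mem _
    | add t s _ _ ht hs => rw [mul_add]; exact add_mem ht hs
    | smul c t _ ht => rw [mul_smul_comm]; exact smul_mem _ c ht
  | add a _ b _ ha hb => rw [mul_add]; exact add_mem ha hb

/-- For `r = 2` and `r = 3`, the only nonzero product of `c^(r - 1)` with an arrow is
`c^r = b₂b₁a₁a₂`, which lies in the fourth power of the radical. An element congruent to `c^(r - 1)`
modulo `radʳ` does not annihilate `c`, as `radʳ · c = 0` and `c^r ≠ 0`. -/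
theorem not_hasTightGrading_of_lt_four (hr : 2 ≤ r) (hr' : r < 4) :
    ¬ HasTightGrading k (quiverGenericC k r).QuotAlgebra := by
  intro h
  obtain ⟨s, rfl⟩ : ∃ s, r = s + 1 + 1 := ⟨r - 2, by omega⟩
  have hcr : c.toAlg k (s + 2) ^ (s + 2) ∈
      radFiltration k (quiverGenericC k (s + 2)).QuotAlgebra (s + 3) := by
    rw [c_pow]
    exact radFiltration_antitone (by omega : s + 3 ≤ 4)
      (radFiltration_mul_mem (m := 3) b2_mul_b1_mul_a1_mem_radFiltration
        (toAlg_mem_radFiltration a2))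
  have hmul : ∀ f : Quiver.Total CVertex,
      c.toAlg k (s + 2) ^ (s + 1) * CArrow.toAlg k (s + 2) (show CArrow f.left f.right from f.hom) ∈
        radFiltration k (quiverGenericC k (s + 2)).QuotAlgebra (s + 1 + 2) := by
    have hz : ∀ {v w} (f : CArrow v w), c.toAlg k (s + 2) * f.toAlg k (s + 2) = 0 →
        c.toAlg k (s + 2) ^ (s + 1) * f.toAlg k (s + 2) ∈
          radFiltration k (quiverGenericC k (s + 2)).QuotAlgebra (s + 1 + 2) := fun f hf => by
      rw [pow_succ, mul_assoc, hf, mul_zero]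
      exact zero_mem _
    refine CArrow.forall_total (hz a1 ?_) (hz a2 ?_) (hz b1 ?_) (hz b2 c_mul_b2) ?_
    iterate 3 exact CArrow.mul_eq_zero _ _ (by simp)
    exact (pow_succ (c.toAlg k (s + 2)) (s + 1)).symm ▸ hcr
  obtain ⟨y, hy, hy'⟩ := exists_sub_mem_radFiltration_and_mul_eq_zero h
    (c_pow_mem_radFiltration (s + 1)) (mul_mem_radFiltration_of_forall hmul)
  refine c_pow_ne_zero k (r := s + 2) (by omega) ?_
  have h1 := mul_eq_zero_of_mem_radFiltration arrowSpanC_pow_mul_c hy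
  rwa [sub_mul, hy' _ (toAlg_mem_radFiltration c), sub_zero, ← pow_succ] at h1

/-- For `r ≥ 5`, the only nonzero product of `b₂b₁a₁` with an arrow is `b₂b₁a₁a₂ = c^r`, which lies
in the fifth power of the radical. An element congruent to `b₂b₁a₁` modulo `rad⁴` does not
annihilate `a₂`, as `rad⁴ · a₂ = 0` and `c^r ≠ 0`. -/
theorem not_hasTightGrading_of_four_lt (hr : 4 < r) :
    ¬ HasTightGrading k (quiverGenericC k r).QuotAlgebra := by
  intro h
  have hmul : ∀ f : Quiver.Total CVertex, b2.toAlg k r * b1.toAlg k r * a1.toAlg k r *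
      CArrow.toAlg k r (show CArrow f.left f.right from f.hom) ∈
        radFiltration k (quiverGenericC k r).QuotAlgebra (3 + 2) := by
    have hz : ∀ {v w} (f : CArrow v w), a1.toAlg k r * f.toAlg k r = 0 →
        b2.toAlg k r * b1.toAlg k r * a1.toAlg k r * f.toAlg k r ∈
          radFiltration k (quiverGenericC k r).QuotAlgebra (3 + 2) := fun f hf => by
      rw [mul_assoc, hf, mul_zero]
      exact zero_mem _
    refine CArrow.forall_total (hz a1 ?_) ?_ (hz b1 a1_mul_b1) (hz b2 ?_) (hz c ?_)
    · exact CArrow.mul_eq_zero _ _ (by simp)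
    · exact c_pow (k := k) (r := r) ▸ radFiltration_antitone hr (c_pow_mem_radFiltration r)
    iterate 2 exact CArrow.mul_eq_zero _ _ (by simp)
  obtain ⟨y, hy, hy'⟩ := exists_sub_mem_radFiltration_and_mul_eq_zero h
    b2_mul_b1_mul_a1_mem_radFiltration (mul_mem_radFiltration_of_forall hmul)
  refine c_pow_ne_zero k (r := r) (by omega) ?_
  have h1 := mul_eq_zero_of_mem_radFiltration arrowSpanC_pow_four_mul_a2 hy
  rwa [sub_mul, hy' _ (toAlg_mem_radFiltration a2), sub_zero, ← c_pow] at h1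

open Polynomial in
/-- For `r = 4`, all relations of `C_r` are homogeneous. -/
theorem hasTightGrading_quiverGenericC_four :
    HasTightGrading k (quiverGenericC k 4).QuotAlgebra := by
  refine QuiverWithRelations.hasTightGrading _ ?_
  have hcomm := a2_mul_b2_mul_b1_mul_a1_mul (k := k) (r := 4) 1
  simp only [mul_one, ← mul_assoc] at hcomm
  refine CRel.map_eq (k := k) (r := 4)
    (PathAlgebra.lift (quiverGenericC k 4).isPathFamily.polynomial)
    (x := fun f => monomial 1 (f.toAlg k 4))
    (fun {v w} f => (PathAlgebra.lift_arrow (quiverGenericC k 4).isPathFamily.polynomial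
      (show v ⟶ w from f)).trans C_mul_X_eq_monomial) ?_ ?_ ?_ ?_ ?_ ?_ <;>
    simp only [monomial_mul_monomial, monomial_pow, a1_mul_b1, b2_mul_a2, a2_mul_c, c_mul_b2, c_pow,
      hcomm, monomial_zero_right]

end TightC

/-! ### The algebra `C_1 = A_1` -/

section AlgebraA

open AArrow Submodule

variable (k : Type u) [Field k]

theorem AArrow.forall_total {P : Quiver.Total AVertex → Prop} (h₁ : P ⟨_, _, AArrow.a1⟩)
    (h₂ : P ⟨_, _, AArrow.a2⟩) (h₃ : P ⟨_, _, AArrow.b1⟩) (h₄ : P ⟨_, _, AArrow.b2⟩) : ∀ f, P f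
  | ⟨_, _, f⟩ => match f with
    | .a1 => h₁
    | .a2 => h₂
    | .b1 => h₃
    | .b2 => h₄

instance (r : ℕ) : Finite (Quiver.Total (quiverA k r).V) :=
  Finite.of_surjective (fun i : Fin 4 =>
    (![⟨_, _, AArrow.a1⟩, ⟨_, _, AArrow.a2⟩, ⟨_, _, AArrow.b1⟩, ⟨_, _, AArrow.b2⟩] i :
      Quiver.Total AVertex))
    (AArrow.forall_total ⟨0, rfl⟩ ⟨1, rfl⟩ ⟨2, rfl⟩ ⟨3, rfl⟩)

/-- The projection from the path algebra to `A_1`. -/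
noncomputable def projA : PathAlgebra k AVertex →ₐ[k] (quiverA k 1).QuotAlgebra :=
  (quiverA k 1).proj

/-- An arrow of the quiver of `A_1` as an element of `A_1`. -/
noncomputable def AArrow.toAlg {v w : AVertex} (f : AArrow v w) : (quiverA k 1).QuotAlgebra :=
  projA k (f.path k)

variable {k}

theorem projA_eq_of_rel {a b : PathAlgebra k AVertex} (h : ARel k 1 a b) :
    projA k a = projA k b :=
  QuiverWithRelations.proj_eq_of_rel (Q := quiverA k 1) h

theorem AArrow.mul_eq_zero {v w v' w' : AVertex} (f : AArrow v w) (g : AArrow v' w')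
    (h : w ≠ v') : f.toAlg k * g.toAlg k = 0 :=
  (quiverA k 1).isPathFamily.mul_eq_zero (f := ⟨v, w, f⟩) (g := ⟨v', w', g⟩) h

theorem AArrow.a2_mul_a1 : a2.toAlg k * a1.toAlg k = 0 := by
  simpa only [AArrow.toAlg, map_mul, map_zero] using projA_eq_of_rel (k := k) ARel.a2a1

theorem AArrow.b2_mul_b1 : b2.toAlg k * b1.toAlg k = 0 := by
  simpa only [AArrow.toAlg, map_mul, map_zero] using projA_eq_of_rel (k := k) ARel.b2b1

theorem AArrow.a1_mul_a2_mul_b1_mul_b2 : a1.toAlg k * a2.toAlg k * b1.toAlg k * b2.toAlg k =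
    b1.toAlg k * b2.toAlg k * a1.toAlg k * a2.toAlg k := by
  simpa only [AArrow.toAlg, map_mul, pow_one] using projA_eq_of_rel (k := k) ARel.pow

theorem AArrow.a2_mul_a1_mul (z) : a2.toAlg k * (a1.toAlg k * z) = 0 := by
  rw [← mul_assoc, a2_mul_a1, zero_mul]

theorem AArrow.b2_mul_b1_mul (z) : b2.toAlg k * (b1.toAlg k * z) = 0 := by
  rw [← mul_assoc, b2_mul_b1, zero_mul]

theorem AArrow.a1_mul_a2_mul_b1_mul_b2_mul (z) :
    a1.toAlg k * (a2.toAlg k * (b1.toAlg k * (b2.toAlg k * z))) =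
      b1.toAlg k * (b2.toAlg k * (a1.toAlg k * (a2.toAlg k * z))) := by
  simp only [← mul_assoc, a1_mul_a2_mul_b1_mul_b2]

variable (k) in
/-- The span of the arrows in `A_1`. -/
noncomputable abbrev arrowSpanA : Submodule k (quiverA k 1).QuotAlgebra :=
  span k (Set.range (quiverA k 1).arrow)

theorem arrowSpanA_mul_a1 (z) :
    arrowSpanA k * span k {a1.toAlg k * z} ≤ span k {b2.toAlg k * (a1.toAlg k * z)} :=
  span_range_mul_span_singleton_le (AArrow.forall_total
    (mem_span_singleton_of_eq_zero (AArrow.mul_eq_zero a1 a1 (by simp)))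
    (mem_span_singleton_of_eq_zero a2_mul_a1)
    (mem_span_singleton_of_eq_zero (AArrow.mul_eq_zero b1 a1 (by simp)))
    (mem_span_singleton_self _)) z

theorem arrowSpanA_mul_a2 (z) :
    arrowSpanA k * span k {a2.toAlg k * z} ≤ span k {a1.toAlg k * (a2.toAlg k * z)} :=
  span_range_mul_span_singleton_le (AArrow.forall_total
    (mem_span_singleton_self _)
    (mem_span_singleton_of_eq_zero (AArrow.mul_eq_zero a2 a2 (by simp)))
    (mem_span_singleton_of_eq_zero (AArrow.mul_eq_zero b1 a2 (by simp)))
    (mem_span_singleton_of_eq_zero (AArrow.mul_eq_zero b2 a2 (by simp)))) z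

theorem arrowSpanA_mul_b1 (z) :
    arrowSpanA k * span k {b1.toAlg k * z} ≤ span k {a2.toAlg k * (b1.toAlg k * z)} :=
  span_range_mul_span_singleton_le (AArrow.forall_total
    (mem_span_singleton_of_eq_zero (AArrow.mul_eq_zero a1 b1 (by simp)))
    (mem_span_singleton_self _)
    (mem_span_singleton_of_eq_zero (AArrow.mul_eq_zero b1 b1 (by simp)))
    (mem_span_singleton_of_eq_zero b2_mul_b1)) z

theorem arrowSpanA_mul_b2 (z) :
    arrowSpanA k * span k {b2.toAlg k * z} ≤ span k {b1.toAlg k * (b2.toAlg k * z)} :=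
  span_range_mul_span_singleton_le (AArrow.forall_total
    (mem_span_singleton_of_eq_zero (AArrow.mul_eq_zero a1 b2 (by simp)))
    (mem_span_singleton_of_eq_zero (AArrow.mul_eq_zero a2 b2 (by simp)))
    (mem_span_singleton_self _)
    (mem_span_singleton_of_eq_zero (AArrow.mul_eq_zero b2 b2 (by simp)))) z

theorem arrowSpanA_pow_four_mul_a1 : arrowSpanA k ^ 4 * span k {a1.toAlg k} = ⊥ := by
  have h := pow_four_mul_span_singleton_le (arrowSpanA_mul_a1 (k := k) 1)
    (arrowSpanA_mul_b2 _) (arrowSpanA_mul_b1 _) (arrowSpanA_mul_a2 _)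
  simp only [a1_mul_a2_mul_b1_mul_b2_mul, a2_mul_a1_mul, mul_zero] at h
  rwa [mul_one, span_zero_singleton, le_bot_iff] at h

theorem arrowSpanA_pow_four_mul_a2 : arrowSpanA k ^ 4 * span k {a2.toAlg k} = ⊥ := by
  have h := pow_four_mul_span_singleton_le (arrowSpanA_mul_a2 (k := k) 1)
    (arrowSpanA_mul_a1 _) (arrowSpanA_mul_b2 _) (arrowSpanA_mul_b1 _)
  simp only [← a1_mul_a2_mul_b1_mul_b2_mul, a2_mul_a1_mul] at h
  rwa [mul_one, span_zero_singleton, le_bot_iff] at h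

theorem arrowSpanA_pow_four_mul_b1 : arrowSpanA k ^ 4 * span k {b1.toAlg k} = ⊥ := by
  have h := pow_four_mul_span_singleton_le (arrowSpanA_mul_b1 (k := k) 1)
    (arrowSpanA_mul_a2 _) (arrowSpanA_mul_a1 _) (arrowSpanA_mul_b2 _)
  simp only [← a1_mul_a2_mul_b1_mul_b2_mul, b2_mul_b1_mul, mul_zero] at h
  rwa [mul_one, span_zero_singleton, le_bot_iff] at h

theorem arrowSpanA_pow_four_mul_b2 : arrowSpanA k ^ 4 * span k {b2.toAlg k} = ⊥ := by
  have h := pow_four_mul_span_singleton_le (arrowSpanA_mul_b2 (k := k) 1)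
    (arrowSpanA_mul_b1 _) (arrowSpanA_mul_a2 _) (arrowSpanA_mul_a1 _)
  simp only [a1_mul_a2_mul_b1_mul_b2_mul, b2_mul_b1_mul] at h
  rwa [mul_one, span_zero_singleton, le_bot_iff] at h

variable (k) in
theorem arrowSpanA_pow_eq_bot : arrowSpanA k ^ (4 + 1) = ⊥ :=
  pow_succ_span_range_eq_bot (AArrow.forall_total arrowSpanA_pow_four_mul_a1
    arrowSpanA_pow_four_mul_a2 arrowSpanA_pow_four_mul_b1 arrowSpanA_pow_four_mul_b2)

instance : Module.Finite k (quiverA k 1).QuotAlgebra :=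
  (quiverA k 1).isPathFamily.finite_of_pow_eq_bot (quiverA k 1).adjoin_eq_top
    (arrowSpanA_pow_eq_bot k)

/-- A homomorphism from the path algebra respects the relations of `A_1` as soon as the images of
the arrows satisfy them. -/
theorem ARel.map_eq {B : Type*} [Ring B] [Algebra k B] (F : PathAlgebra k AVertex →ₐ[k] B)
    {x : ∀ {v w : AVertex}, AArrow v w → B} (hF : ∀ {v w} (f : AArrow v w), F (f.path k) = x f)
    (h₁ : x a2 * x a1 = 0) (h₂ : x b2 * x b1 = 0)
    (h₃ : x a1 * x a2 * x b1 * x b2 = x b1 * x b2 * x a1 * x a2) :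
    ∀ a b, ARel k 1 a b → F a = F b := by
  intro a b hab
  cases hab <;> simpa only [map_mul, map_pow, map_zero, pow_one, hF]

open Polynomial in
/-- All relations of `A_1` are homogeneous. -/
theorem hasTightGrading_quiverA_one : HasTightGrading k (quiverA k 1).QuotAlgebra := by
  refine QuiverWithRelations.hasTightGrading _ ?_
  refine ARel.map_eq (k := k) (PathAlgebra.lift (quiverA k 1).isPathFamily.polynomial)
    (x := fun f => monomial 1 (f.toAlg k))
    (fun {v w} f => (PathAlgebra.lift_arrow (quiverA k 1).isPathFamily.polynomial
      (show v ⟶ w from f)).trans C_mul_X_eq_monomial) ?_ ?_ ?_ <;>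
    simp only [monomial_mul_monomial, a2_mul_a1, b2_mul_b1, a1_mul_a2_mul_b1_mul_b2,
      monomial_zero_right]

end AlgebraA

/-! ### The classification -/

theorem quiverC_one (k : Type u) [Field k] : quiverC k 1 = quiverA k 1 :=
  if_pos rfl

instance (k : Type u) [Field k] (r : ℕ) : Module.Finite k (BlockC k r) := by
  rcases eq_or_ne r 1 with rfl | hr
  · unfold BlockC
    rw [quiverC_one]
    infer_instance
  · unfold BlockC
    rw [quiverC_of_ne_one k r hr]
    infer_instance

theorem hasTightGrading_blockC_iff (k : Type u) [Field k] {r : ℕ} (hr : 1 ≤ r) :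
    HasTightGrading k (BlockC k r) ↔ r = 1 ∨ r = 4 := by
  constructor
  · intro h
    by_contra! hne
    unfold BlockC at h
    rw [quiverC_of_ne_one k r hne.1] at h
    rcases lt_or_gt_of_ne hne.2 with h4 | h4
    · exact not_hasTightGrading_of_lt_four (by omega) h4 h
    · exact not_hasTightGrading_of_four_lt h4 h
  · rintro (rfl | rfl)
    · unfold BlockC
      rw [quiverC_one]
      exact hasTightGrading_quiverA_one
    · unfold BlockC
      rw [quiverC_of_ne_one k 4 (by norm_num)]
      exact hasTightGrading_quiverGenericC_four

theorem mainTheorem9 (k : Type*) [Field k] [IsAlgClosed k] [CharP k 2] (r : ℕ) (hr : 1 ≤ r) :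
    (IsTightlyGraded k (BlockC k r) ↔ r = 1 ∨ r = 4) ∧
      (HasTightGrading k (BlockC k r) ↔ r = 1 ∨ r = 4) :=
  ⟨isTightlyGraded_iff_hasTightGrading.trans (hasTightGrading_blockC_iff k hr),
    hasTightGrading_blockC_iff k hr⟩
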